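/- A binary CSP instance $I$ consists of a finite set $X$ of variables, a finite set $D$ of values, a domain $D(x)\subseteq D$ for each $x\in X$, and a relation $R(x,y)\subseteq D^2$ for each pair of distinct variables, where $(a,b)\in R(x,y)$ if and only if $(b,a)\in R(y,x)$. A point of $I$ is a pair $(x,a)$ with $a\in D(x)$; for $x\ne y$ the points $(x,a),(y,b)$ form a positive edge if $(a,b)\in R(x,y)$ and a negative edge otherwise. A solution is a map $s$ with $s(x)\in D(x)$ for all $x$ and $(s(x),s(y))\in R(x,y)$ for all $x\neq y$; an instance is satisfiable if it has a solution. Deleting the constraint between two distinct variables means replacing it by a trivial one (all pairs allowed). $I$ is arc consistent if for every point $(x,a)$ and every variable $y\ne x$ some $b\in D(y)$ has $(a,b)\in R(x,y)$. A point $(x,a)$ is singleton arc consistent if, after replacing $D(x)$ by $\{a\}$, values can be removed from the domains so that the instance becomes arc consistent and no domain is empty. $I$ is singleton arc consistent (SAC) if all its points are. Establishing SAC means removing points that are not singleton arc consistent (in the current instance), one after the other, until the instance is SAC. SAC decides $I$ if the following holds: if all domains are non-empty after SAC has been established on $I$, then $I$ has a solution. A pattern is a set of points, each belonging to a variable, with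 some pairs of points of distinct variables marked as positive edges and some others as negative edges. It occurs in $I$ if there is a map from its points to the points of $I$ such that two points go to the same variable if and only if they belong to the same variable of the pattern, and positive (negative) edges go to positive (negative) edges. A pattern $P$ is SAC-solvable if SAC decides every binary CSP instance in which $P$ does not occur. Consider the following patterns on four variables; points enclosed in the same braces belong to the same variable. * $Q1$: variables $\{p\},\{a,b,c\},\{q\},\{r\}$; positive edges $pc, qa, rb$; negative edges $pb, qc, ra$. * $Q2$: variables $\{p\},\{a,b\},\{q\},\{r\}$; positive edges $pb, ra$; negative edges $pa, qa, rb$. * $R5$: variables $\{p\},\{a,b\},\{c,d\},\{q\}$; positive edges $pa, ad, bc, cq$; negative edges $pb, ac, dq$. * $R8$: variables $\{p\},\{a,b,e\},\{c,d\},\{q\}$; positive edges $pa, pe, ad, ec, cq$; negative edges $pb, ac, dq$. * $R7^-$: variables $\{p\},\{a,b\},\{c,d,e\},\{q\}$; positive edges $pb, bd, be, eq$; negative edges $pa, bc, dq$. **Theorem.** Each of the patterns $Q1$, $Q2$, $R5$, $R8$ and $R7^-$ is SAC-solvable. Moreover, if $I$ is a singleton arc consistent binary CSP instance in which $R5$ does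 not occur, then deleting the constraint between any two distinct variables does not change the satisfiability of $I$. -/

import Mathlib

universe u v

namespace BinaryCSP

/-- A binary CSP instance with variable set `X` and overall domain `D` (both are assumed finite
where the notion is used).  `I.dom x` is the domain of the variable `x`, and `I.rel x y` is the
constraint relation `R(x,y)` for distinct `x`, `y`; an absent constraint is a trivial relation.
The values of `rel x x` are irrelevant. -/
structure Instance (X : Type u) (D : Type v) where
  dom : X → Set D
  rel : X → X → D → D → Prop
  rel_symm : ∀ x y a b, x ≠ y → (rel x y a b ↔ rel y x b a)

namespace Instance

variable {X : Type u} {D : Type v}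

/-- A solution: one value from the domain of each variable, satisfying every constraint. -/
def IsSolution (I : Instance X D) (s : X → D) : Prop :=
  (∀ x, s x ∈ I.dom x) ∧ ∀ x y, x ≠ y → I.rel x y (s x) (s y)

def Satisfiable (I : Instance X D) : Prop := ∃ s, I.IsSolution s

/-- The same constraints with other variable domains. -/
def withDom (I : Instance X D) (E : X → Set D) : Instance X D where
  dom := E
  rel := I.rel
  rel_symm := I.rel_symm

/-- Every value in the domain of a variable has a support at every other variable. -/
def ArcConsistent (I : Instance X D) : Prop :=
  ∀ x, ∀ a ∈ I.dom x, ∀ y, x ≠ y → ∃ b ∈ I.dom y, I.rel x y a b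

/-- Some way of removing values from the domains makes the instance arc consistent without
emptying any domain. -/
def CanBeMadeArcConsistent (I : Instance X D) : Prop :=
  ∃ E : X → Set D, (∀ x, E x ⊆ I.dom x) ∧ (∀ x, (E x).Nonempty) ∧ (I.withDom E).ArcConsistent

/-- The instance obtained by removing from the domain of `x` all values other than `a`. -/
def assign (I : Instance X D) (x : X) (a : D) : Instance X D :=
  I.withDom fun y => {b | b ∈ I.dom y ∧ (y = x → b = a)}

/-- The value `a` of the variable `x` is singleton arc consistent. -/
def ValueSAC (I : Instance X D) (x : X) (a : D) : Prop :=
  (I.assign x a).CanBeMadeArcConsistent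

/-- Singleton arc consistency (SAC) of an instance. -/
def SingletonArcConsistent (I : Instance X D) : Prop :=
  ∀ x, ∀ a ∈ I.dom x, I.ValueSAC x a

/-- The instance obtained by removing the value `a` from the domain of `x`. -/
def removeValue (I : Instance X D) (x : X) (a : D) : Instance X D :=
  I.withDom fun y => {b | b ∈ I.dom y ∧ ¬ (y = x ∧ b = a)}

/-- One step of establishing SAC: a value that is not singleton arc consistent is removed. -/
def SACStep (I J : Instance X D) : Prop :=
  ∃ x, ∃ a ∈ I.dom x, ¬ I.ValueSAC x a ∧ J = I.removeValue x a

/-- `J` results from `I` by establishing singleton arc consistency: values that are not singleton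
arc consistent are removed, one after the other, until none is left. -/
def EstablishesSAC (I J : Instance X D) : Prop :=
  Relation.ReflTransGen SACStep I J ∧ J.SingletonArcConsistent

/-- SAC decides `I`: if no domain is empty after establishing SAC, then `I` has a solution. -/
def DecidedBySAC (I : Instance X D) : Prop :=
  ∀ J : Instance X D, I.EstablishesSAC J → (∀ x, (J.dom x).Nonempty) → I.Satisfiable

/-- Establishing SAC always terminates on a finite instance, so that `DecidedBySAC` is not vacuous. -/
theorem exists_establishesSAC [Finite X] [Finite D] (I : Instance X D) :
    ∃ J, I.EstablishesSAC J := by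
  have key : ∀ (n : ℕ) (I : Instance X D),
      {p : X × D | p.2 ∈ I.dom p.1}.ncard ≤ n → ∃ J, I.EstablishesSAC J := by
    intro n
    induction n with
    | zero =>
      intro I h
      refine ⟨I, Relation.ReflTransGen.refl, fun x a ha => ?_⟩
      have h0 : {p : X × D | p.2 ∈ I.dom p.1} = ∅ :=
        (Set.ncard_eq_zero (Set.toFinite _)).1 (Nat.le_zero.1 h)
      have hx : (x, a) ∈ {p : X × D | p.2 ∈ I.dom p.1} := ha
      rw [h0] at hx
      exact hx.elim
    | succ n ih =>
      intro I h
      by_cases hI : I.SingletonArcConsistent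
      · exact ⟨I, Relation.ReflTransGen.refl, hI⟩
      · unfold SingletonArcConsistent at hI
        push Not at hI
        obtain ⟨x, a, ha, hn⟩ := hI
        have hlt : {p : X × D | p.2 ∈ (I.removeValue x a).dom p.1}.ncard
            < {p : X × D | p.2 ∈ I.dom p.1}.ncard := by
          refine Set.ncard_lt_ncard ?_ (Set.toFinite _)
          refine (Set.ssubset_iff_of_subset fun p hp => hp.1).2 ⟨(x, a), ha, fun hp => ?_⟩
          exact hp.2 ⟨rfl, rfl⟩
        obtain ⟨J, hJ, hs⟩ := ih (I.removeValue x a) (by omega)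
        exact ⟨J, Relation.ReflTransGen.head ⟨x, a, ha, hn, rfl⟩ hJ, hs⟩
  exact key _ I le_rfl

/-- Deleting the constraint between `x` and `y`: it is replaced by a trivial one. -/
def deleteConstraint (I : Instance X D) (x y : X) : Instance X D where
  dom := I.dom
  rel z w a b := I.rel z w a b ∨ (z = x ∧ w = y) ∨ (z = y ∧ w = x)
  rel_symm z w a b h := by
    have := I.rel_symm z w a b h
    tauto

end Instance

/-- A pattern: points belonging to variables, with a partial compatibility function on the pairs of
points of different variables, given by its positive and its negative edges. -/
structure Pattern where
  Var : Type
  Point : Type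
  var : Point → Var
  pos : Point → Point → Prop
  neg : Point → Point → Prop
  pos_symm : ∀ p q, pos p q → pos q p
  neg_symm : ∀ p q, neg p q → neg q p
  var_ne_of_pos : ∀ p q, pos p q → var p ≠ var q
  var_ne_of_neg : ∀ p q, neg p q → var p ≠ var q
  not_neg_of_pos : ∀ p q, pos p q → ¬ neg p q

namespace Pattern

/-- `P` occurs in `I`: the points of `P` can be mapped to points `(x, a)`, `a ∈ D(x)`, of `I`, where
two points go to the same variable iff they belong to the same variable of `P`, such that
positive edges go to positive edges and negative edges to negative edges. -/
def OccursIn (P : Pattern) {X : Type u} {D : Type v} (I : Instance X D) : Prop :=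
  ∃ (x : P.Point → X) (a : P.Point → D),
    (∀ p, a p ∈ I.dom (x p)) ∧
    (∀ p q, x p = x q ↔ P.var p = P.var q) ∧
    (∀ p q, P.pos p q → I.rel (x p) (x q) (a p) (a q)) ∧
    (∀ p q, P.neg p q → ¬ I.rel (x p) (x q) (a p) (a q))

/-- The class of binary CSP instances in which `P` does not occur. -/
def CSP (P : Pattern) (X : Type u) (D : Type v) : Set (Instance X D) :=
  {I | ¬ P.OccursIn I}

/-- `P` is SAC-solvable: SAC decides every (finite) binary CSP instance in which `P` does not
occur. -/
def SACSolvable (P : Pattern) : Prop :=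
  ∀ (X : Type u) (D : Type v) [Finite X] [Finite D], ∀ I ∈ P.CSP X D, I.DecidedBySAC

/-- The pattern with points `0, …, n - 1` and variables `0, …, k - 1` whose (undirected) positive
and negative edges are those listed. -/
def ofEdges {n k : ℕ} (var : Fin n → Fin k) (pos neg : List (Fin n × Fin n))
    (hpos : ∀ e ∈ pos, var e.1 ≠ var e.2) (hneg : ∀ e ∈ neg, var e.1 ≠ var e.2)
    (hdisj : ∀ e ∈ pos, e ∉ neg ∧ e.swap ∉ neg) : Pattern where
  Var := Fin k
  Point := Fin n
  var := var
  pos p q := (p, q) ∈ pos ∨ (q, p) ∈ pos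
  neg p q := (p, q) ∈ neg ∨ (q, p) ∈ neg
  pos_symm _ _ h := h.symm
  neg_symm _ _ h := h.symm
  var_ne_of_pos p q h := h.elim (fun h => hpos _ h) (fun h => (hpos _ h).symm)
  var_ne_of_neg p q h := h.elim (fun h => hneg _ h) (fun h => (hneg _ h).symm)
  not_neg_of_pos p q h := by
    rcases h with h | h
    · have := hdisj _ h
      simp only [Prod.swap] at this
      tauto
    · have := hdisj _ h
      simp only [Prod.swap] at this
      tauto

/-- Q1: the central variable `1` has the points `1`, `2`, `3`; the other three variables have the
single points `0`, `4`, `5`. -/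
def Q1 : Pattern :=
  ofEdges (n := 6) (k := 4) ![0, 1, 1, 1, 2, 3]
    [(0, 3), (1, 4), (2, 5)]
    [(0, 2), (3, 4), (1, 5)]
    (by decide) (by decide) (by decide)

/-- Q2: the central variable `1` has the points `1`, `2`; the other three variables have the single
points `0`, `3`, `4`. -/
def Q2 : Pattern :=
  ofEdges (n := 5) (k := 4) ![0, 1, 1, 2, 3]
    [(0, 2), (1, 4)]
    [(0, 1), (1, 3), (2, 4)]
    (by decide) (by decide) (by decide)

/-- R5: a chain of four variables with the points `0`; `1`, `2`; `3`, `4`; `5`. -/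
def R5 : Pattern :=
  ofEdges (n := 6) (k := 4) ![0, 1, 1, 2, 2, 3]
    [(0, 1), (1, 4), (2, 3), (3, 5)]
    [(0, 2), (1, 3), (4, 5)]
    (by decide) (by decide) (by decide)

/-- R8: a chain of four variables with the points `0`; `1`, `2`, `3`; `4`, `5`; `6`. -/
def R8 : Pattern :=
  ofEdges (n := 7) (k := 4) ![0, 1, 1, 1, 2, 2, 3]
    [(0, 1), (0, 3), (1, 5), (3, 4), (4, 6)]
    [(0, 2), (1, 4), (5, 6)]
    (by decide) (by decide) (by decide)

/-- R7-: a chain of four variables with the points `0`; `1`, `2`; `3`, `4`, `5`; `6`. -/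
def R7minus : Pattern :=
  ofEdges (n := 7) (k := 4) ![0, 1, 1, 2, 2, 2, 3]
    [(0, 2), (2, 4), (2, 5), (5, 6)]
    [(0, 1), (2, 3), (4, 6)]
    (by decide) (by decide) (by decide)

end Pattern

end BinaryCSP

/-!
All five classes of instances are closed under restricting domains and under deleting constraints:
in the patterns every positive edge runs parallel to a negative one (`Pattern.IsMonotone`).
Satisfiability of a singleton arc consistent instance with nonempty domains is therefore proved by
induction on the number of points and nontrivial constraints (`Pattern.SACSolvable.of_admits`).
Singleton arc consistency supplies, for each point `(x, a)`, an arc consistent family of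
subdomains in which `x` has the single value `a`
(`Instance.SingletonArcConsistent.exists_family`).

Two reductions are used. Values of a set `S` of variables that are compatible with each other and
with everything outside `S` can be assigned at once, and the constraints at `S` deleted
(`Pattern.Admits.satisfiable_of_autark`). A value all of whose compatible points are compatible
with another value of the same variable can be removed
(`Pattern.Admits.satisfiable_of_dominated`).

* `R5`: a solution of the instance without one constraint is repaired by changing at most two of
  its values. The claim about deleting constraints follows from the solvability of `R5`: an
  instance and the instance with a constraint deleted have the same domains, and as soon as these
  are nonempty both instances are satisfiable.
* `R8`, `R7⁻`, `Q2`: starting from the family of one point, a trace collects the variables that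
  the values fixed so far restrict, fixing a value for each of them. For `R8` the family stays arc
  consistent when the new value is fixed and the values incompatible with it are deleted. For
  `R7⁻` the values left for the new variable are indistinguishable from outside the trace as soon
  as each value of the trace is constrained from within it (`Pattern.IsR7Trace.exists_insert`);
  the difficulty lies in starting such a trace, see `Pattern.Admits.satisfiable_of_pointsTo`. For
  `Q2`, in the absence of dominated values, a value restricted by one variable restricts at most
  one other variable, so the trace consists of paths that can be followed one after the other.
* `Q1`: say that a variable prefers `a` to `b` if it has a value compatible with `a` but not with
  `b`. Absence of `Q1` means that no three values of a variable are preferred to each other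
  cyclically by three distinct variables. By Hall's condition on triples of values
  (`exists_two_or_two_classes`) each variable has at most two neighbours, or its values fall into
  two classes inside of which only one other variable distinguishes. Passing to classes leaves
  variables with two values or with two neighbours; the latter are eliminated by composing their
  two constraints, and the result is an instance of 2-satisfiability (`Net.exists_isSolution`).
-/

/-! ### Arc consistent families, deletion of constraints and of values -/

namespace BinaryCSP

open Set

namespace Instance

variable {X : Type u} {D : Type v} {I : Instance X D}

/-- Nonempty subdomains `E x ⊆ I.dom x` on which the instance is arc consistent. -/
structure IsACFamily (I : Instance X D) (E : X → Set D) : Prop where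
  subset : ∀ x, E x ⊆ I.dom x
  nonempty : ∀ x, (E x).Nonempty
  support : ∀ x y, x ≠ y → ∀ a ∈ E x, ∃ b ∈ E y, I.rel x y a b

theorem SingletonArcConsistent.exists_family (h : I.SingletonArcConsistent) {x : X} {a : D}
    (ha : a ∈ I.dom x) : ∃ E, I.IsACFamily E ∧ E x = {a} := by
  obtain ⟨E, hsub, hne, hac⟩ := h x a ha
  refine ⟨E, ⟨fun y b hb => (hsub y hb).1, hne, fun y z hyz b hb => hac y b hb z hyz⟩, ?_⟩
  exact (hne x).subset_singleton_iff.1 fun b hb => (hsub x hb).2 rfl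

theorem SingletonArcConsistent.of_families
    (h : ∀ x, ∀ a ∈ I.dom x, ∃ E, I.IsACFamily E ∧ E x = {a}) : I.SingletonArcConsistent := by
  intro x a ha
  obtain ⟨E, hE, hx⟩ := h x a ha
  refine ⟨E, fun y b hb => ⟨hE.subset y hb, ?_⟩, hE.nonempty,
    fun y b hb z hyz => hE.support y z hyz b hb⟩
  rintro rfl
  rw [hx] at hb
  exact hb

/-- Singleton arc consistency implies arc consistency. -/
theorem SingletonArcConsistent.exists_support (h : I.SingletonArcConsistent) {x y : X}
    (hxy : x ≠ y) {a : D} (ha : a ∈ I.dom x) : ∃ b ∈ I.dom y, I.rel x y a b := by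
  obtain ⟨E, hE, hx⟩ := h.exists_family ha
  obtain ⟨b, hb, hab⟩ := hE.support x y hxy a (by simp [hx])
  exact ⟨b, hE.subset y hb, hab⟩

theorem rel_comm (I : Instance X D) {x y : X} (h : x ≠ y) {a b : D} :
    I.rel x y a b ↔ I.rel y x b a := I.rel_symm x y a b h

/-- In an arc consistent family, a variable with the single value `a` makes all other values of the
family compatible with `a`. -/
theorem IsACFamily.rel_of_singleton {E : X → Set D} (hE : I.IsACFamily E) {x y : X} (hxy : x ≠ y)
    {a b : D} (hx : E x = {a}) (hb : b ∈ E y) : I.rel x y a b := by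
  obtain ⟨c, hc, hbc⟩ := hE.support y x hxy.symm b hb
  rw [hx] at hc
  obtain rfl : c = a := hc
  exact (I.rel_comm hxy).2 hbc

/-- The value `a` of `x` is compatible with all values of `y`. -/
def Full (I : Instance X D) (x : X) (a : D) (y : X) : Prop := ∀ b ∈ I.dom y, I.rel x y a b

theorem not_full {x y : X} {a : D} : ¬ I.Full x a y ↔ ∃ b ∈ I.dom y, ¬ I.rel x y a b := by
  simp [Full]

/-- All values of `x` are compatible with all values of `y`. -/
def TrivialOn (I : Instance X D) (x y : X) : Prop := ∀ a ∈ I.dom x, I.Full x a y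

/-- The number of points plus the number of ordered pairs of variables with a nontrivial
constraint. -/
noncomputable def size (I : Instance X D) : ℕ :=
  {p : X × D | p.2 ∈ I.dom p.1}.ncard +
    {p : X × X | p.1 ≠ p.2 ∧ ¬ I.TrivialOn p.1 p.2}.ncard

theorem satisfiable_of_trivialOn (hne : ∀ x, (I.dom x).Nonempty)
    (h : ∀ x y, x ≠ y → I.TrivialOn x y) : I.Satisfiable := by
  choose s hs using hne
  exact ⟨s, hs, fun x y hxy => h x y hxy _ (hs x) _ (hs y)⟩

theorem satisfiable_of_update {s : X → D} {x : X} {c : D} (hs : ∀ y, y ≠ x → s y ∈ I.dom y)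
    (hc : c ∈ I.dom x) (hx : ∀ y, x ≠ y → I.rel x y c (s y))
    (h : ∀ y z, y ≠ x → z ≠ x → y ≠ z → I.rel y z (s y) (s z)) : I.Satisfiable := by
  classical
  refine ⟨Function.update s x c, fun y => ?_, fun y z hyz => ?_⟩
  · by_cases hy : y = x
    · subst hy; simpa using hc
    · simpa [hy] using hs y hy
  · by_cases hy : y = x
    · subst hy
      simpa [hyz.symm] using hx z hyz
    · by_cases hz : z = x
      · subst hz
        simpa [hy] using (I.rel_comm hyz).2 (hx y hyz.symm)
      · simpa [hy, hz] using h y z hy hz hyz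

/-- The instance in which the constraints selected by `T` are replaced by trivial ones. -/
def relax (I : Instance X D) (T : X → X → Prop) (hT : ∀ x y, T x y ↔ T y x) : Instance X D where
  dom := I.dom
  rel x y a b := I.rel x y a b ∨ T x y
  rel_symm x y a b h := by rw [I.rel_comm h, hT]

theorem SingletonArcConsistent.relax (h : I.SingletonArcConsistent) (T : X → X → Prop)
    (hT : ∀ x y, T x y ↔ T y x) : (I.relax T hT).SingletonArcConsistent :=
  .of_families fun _ _ ha =>
    let ⟨E, hE, hx⟩ := h.exists_family ha
    ⟨E, ⟨hE.subset, hE.nonempty, fun y z hyz b hb =>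
      let ⟨c, hc, hbc⟩ := hE.support y z hyz b hb
      ⟨c, hc, Or.inl hbc⟩⟩, hx⟩

theorem size_relax_lt [Finite X] (T : X → X → Prop) (hT : ∀ x y, T x y ↔ T y x) {x y : X}
    (hxy : x ≠ y) (hn : ¬ I.TrivialOn x y) (h : T x y) : (I.relax T hT).size < I.size := by
  refine Nat.add_lt_add_left (ncard_lt_ncard ?_ (toFinite _)) _
  refine (ssubset_iff_of_subset ?_).2 ⟨(x, y), ⟨hxy, hn⟩, fun hp => hp.2 ?_⟩
  · rintro p ⟨hp, hp'⟩
    exact ⟨hp, fun ht => hp' fun a ha b hb => Or.inl (ht a ha b hb)⟩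
  · exact fun a _ b _ => Or.inr h

theorem size_withDom_lt [Finite X] [Finite D] {E : X → Set D} (hE : ∀ x, E x ⊆ I.dom x) {x : X}
    {a : D} (ha : a ∈ I.dom x) (ha' : a ∉ E x) : (I.withDom E).size < I.size := by
  refine Nat.add_lt_add_of_lt_of_le (ncard_lt_ncard ?_ (toFinite _))
    (ncard_le_ncard ?_ (toFinite _))
  · refine (ssubset_iff_of_subset ?_).2 ⟨(x, a), ha, ha'⟩
    exact fun p (hp : p.2 ∈ E p.1) => hE _ hp
  · rintro p ⟨hp, hp'⟩
    exact ⟨hp, fun ht => hp' fun a ha b hb => ht a (hE _ ha) b (hE _ hb)⟩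

/-- Establishing singleton arc consistency only shrinks the domains. -/
theorem EstablishesSAC.exists_withDom {J : Instance X D} (h : I.EstablishesSAC J) :
    ∃ E : X → Set D, (∀ x, E x ⊆ I.dom x) ∧ J = I.withDom E := by
  obtain ⟨h, -⟩ := h
  induction h with
  | refl => exact ⟨I.dom, fun _ => Subset.rfl, rfl⟩
  | tail _ hstep ih =>
    obtain ⟨E, hE, rfl⟩ := ih
    obtain ⟨x, a, -, -, rfl⟩ := hstep
    exact ⟨_, fun y b hb => hE y hb.1, rfl⟩

theorem Satisfiable.of_withDom {E : X → Set D} (hE : ∀ x, E x ⊆ I.dom x)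
    (h : (I.withDom E).Satisfiable) : I.Satisfiable :=
  let ⟨s, hs, hs'⟩ := h
  ⟨s, fun x => hE x (hs x), hs'⟩

end Instance

namespace Pattern

variable {X : Type u} {D : Type v} {P : Pattern} {I : Instance X D}

theorem OccursIn.of_withDom {E : X → Set D} (hE : ∀ x, E x ⊆ I.dom x)
    (h : P.OccursIn (I.withDom E)) : P.OccursIn I :=
  let ⟨x, a, hd, hv, hp, hn⟩ := h
  ⟨x, a, fun p => hE _ (hd p), hv, hp, hn⟩

/-- Two variables joined by a positive edge are also joined by a negative edge, so that deleting a
constraint of an instance cannot create an occurrence. -/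
def IsMonotone (P : Pattern) : Prop :=
  ∀ p q, P.pos p q → ∃ p' q', P.var p' = P.var p ∧ P.var q' = P.var q ∧ P.neg p' q'

theorem OccursIn.of_relax (hP : P.IsMonotone) {T : X → X → Prop} {hT : ∀ x y, T x y ↔ T y x}
    (h : P.OccursIn (I.relax T hT)) : P.OccursIn I := by
  obtain ⟨x, a, hd, hv, hp, hn⟩ := h
  refine ⟨x, a, hd, hv, fun p q hpq => ?_, fun p q hpq h => hn p q hpq (Or.inl h)⟩
  refine (hp p q hpq).resolve_right fun hT' => ?_
  obtain ⟨p', q', h1, h2, h3⟩ := hP p q hpq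
  refine hn p' q' h3 (Or.inr ?_)
  rwa [(hv p' p).2 h1, (hv q' q).2 h2]

/-- A singleton arc consistent instance with nonempty domains in which `P` does not occur. -/
structure Admits (P : Pattern) (I : Instance X D) : Prop where
  avoids : ¬ P.OccursIn I
  sac : I.SingletonArcConsistent
  nonempty : ∀ x, (I.dom x).Nonempty

/-- The induction hypothesis: all smaller instances of the class are satisfiable. -/
def SolvesBelow (P : Pattern) (I : Instance X D) : Prop :=
  ∀ J : Instance X D, P.Admits J → J.size < I.size → J.Satisfiable

theorem satisfiable_of_admits
    (h : ∀ I : Instance X D, P.Admits I → P.SolvesBelow I → I.Satisfiable) (I : Instance X D)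
    (hI : P.Admits I) : I.Satisfiable := by
  generalize hn : I.size = n
  induction n using Nat.strong_induction_on generalizing I with
  | _ n ih =>
    subst hn
    exact h I hI fun J hJ hlt => ih _ hlt J hJ rfl

/-- Solvability by singleton arc consistency may be proved by induction on the size of instances that
are already singleton arc consistent. -/
theorem SACSolvable.of_admits
    (h : ∀ (X : Type u) (D : Type v) [Finite X] [Finite D] (I : Instance X D),
      P.Admits I → P.SolvesBelow I → I.Satisfiable) : SACSolvable.{u, v} P := by
  intro X D _ _ I hI J hJ hne
  obtain ⟨E, hE, rfl⟩ := hJ.exists_withDom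
  exact (satisfiable_of_admits (h X D) _
    ⟨fun ho => hI (ho.of_withDom hE), hJ.2, hne⟩).of_withDom hE

/-- If the values `s z`, `z ∈ S`, are compatible with each other and with all values of the
variables outside `S`, then the constraints at `S` may be deleted. -/
theorem Admits.satisfiable_of_autark [Finite X] (hP : P.IsMonotone) (hI : P.Admits I)
    (ih : P.SolvesBelow I) {S : Set X} {s : X → D} (hs : ∀ z ∈ S, s z ∈ I.dom z)
    (hc : ∀ z ∈ S, ∀ w ∈ S, z ≠ w → I.rel z w (s z) (s w))
    (hf : ∀ z ∈ S, ∀ w ∉ S, I.Full z (s z) w)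
    {x y : X} (hx : x ∈ S) (hxy : x ≠ y) (hn : ¬ I.TrivialOn x y) : I.Satisfiable := by
  classical
  have hT : ∀ z w : X, (z ∈ S ∨ w ∈ S) ↔ (w ∈ S ∨ z ∈ S) := fun z w => or_comm
  obtain ⟨t, ht, ht'⟩ := ih (I.relax (fun z w => z ∈ S ∨ w ∈ S) hT)
    ⟨fun h => hI.avoids (h.of_relax hP), hI.sac.relax _ hT, hI.nonempty⟩
    (Instance.size_relax_lt _ hT hxy hn (Or.inl hx))
  refine ⟨fun z => if z ∈ S then s z else t z, fun z => ?_, fun z w hzw => ?_⟩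
  · by_cases hz : z ∈ S
    · simpa [hz] using hs z hz
    · simp only [hz, if_false]
      exact ht z
  · by_cases hz : z ∈ S <;> by_cases hw : w ∈ S <;> simp only [hz, hw, if_true, if_false]
    · exact hc z hz w hw hzw
    · exact hf z hz w hw _ (ht w)
    · exact (I.rel_comm hzw).2 (hf w hw z hz _ (ht z))
    · exact (ht' z w hzw).resolve_right (by simp [hz, hw])

/-- Neighbourhood substitution: a value `b` all of whose compatible points are compatible with `a`
may be removed. -/
theorem Admits.satisfiable_of_dominated [Finite X] [Finite D] (hI : P.Admits I)
    (ih : P.SolvesBelow I) {x : X} {a b : D} (ha : a ∈ I.dom x) (hb : b ∈ I.dom x) (hab : a ≠ b)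
    (h : ∀ y, x ≠ y → ∀ c ∈ I.dom y, I.rel x y b c → I.rel x y a c) : I.Satisfiable := by
  classical
  set G : X → Set D := fun y => {c | c ∈ I.dom y ∧ ¬ (y = x ∧ c = b)} with hG
  have hsub : ∀ y, G y ⊆ I.dom y := fun y c hc => hc.1
  have hxa : a ∈ G x := ⟨ha, fun h => hab h.2⟩
  refine (ih (I.withDom G) ⟨fun h => hI.avoids (h.of_withDom hsub), .of_families ?_, ?_⟩
    (Instance.size_withDom_lt hsub hb (by simp [hG]))).of_withDom hsub
  · intro y c hc
    obtain ⟨E, hE, hy⟩ := hI.sac.exists_family hc.1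
    -- the value `b` is replaced by `a`
    let f : X → D → D := fun z e => if z = x ∧ e = b then a else e
    have hf : ∀ z, ∀ e ∈ I.dom z, f z e ∈ G z := by
      intro z e he
      by_cases h' : z = x ∧ e = b
      · obtain ⟨rfl, rfl⟩ := h'
        simpa [f] using hxa
      · simp only [f, if_neg h']
        exact ⟨he, h'⟩
    have key : ∀ z w e g, z ≠ w → g ∈ I.dom w → I.rel z w e g → I.rel z w (f z e) g := by
      intro z w e g hzw hg hr
      by_cases h' : z = x ∧ e = b
      · obtain ⟨rfl, rfl⟩ := h'
        simpa [f] using h w hzw g hg hr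
      · simpa [f, h'] using hr
    refine ⟨fun z => f z '' E z, ⟨?_, fun z => (hE.nonempty z).image _, ?_⟩, ?_⟩
    · rintro z _ ⟨e, he, rfl⟩
      exact hf z e (hE.subset z he)
    · rintro z w hzw _ ⟨e, he, rfl⟩
      obtain ⟨g, hg, hr⟩ := hE.support z w hzw e he
      refine ⟨_, ⟨g, hg, rfl⟩, ?_⟩
      refine (I.rel_comm hzw).2 (key w z g _ hzw.symm (hsub _ (hf z e (hE.subset z he)))
        ((I.rel_comm hzw).1 ?_))
      exact key z w e g hzw (hE.subset w hg) hr
    · change f y '' E y = {c}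
      rw [hy, image_singleton]
      simp only [f, if_neg hc.2]
  · intro y
    by_cases hy : y = x
    · subst hy
      exact ⟨a, hxa⟩
    · obtain ⟨c, hc⟩ := hI.nonempty y
      exact ⟨c, hc, fun h => hy h.1⟩

end Pattern

end BinaryCSP

/-! ### Occurrences of the five patterns -/

namespace BinaryCSP

open Set

namespace Pattern

variable {X : Type u} {D : Type v} {I : Instance X D}

theorem isMonotone_ofEdges {n k : ℕ} {var : Fin n → Fin k} {pos neg : List (Fin n × Fin n)}
    {hpos hneg hdisj} (h : ∀ e ∈ pos, ∃ e' ∈ neg, (var e'.1 = var e.1 ∧ var e'.2 = var e.2) ∨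
      (var e'.2 = var e.1 ∧ var e'.1 = var e.2)) :
    (ofEdges var pos neg hpos hneg hdisj).IsMonotone := by
  rintro p q (hpq | hpq)
  · obtain ⟨e, he, ⟨h1, h2⟩ | ⟨h1, h2⟩⟩ := h _ hpq
    · exact ⟨e.1, e.2, h1, h2, Or.inl he⟩
    · exact ⟨e.2, e.1, h1, h2, Or.inr he⟩
  · obtain ⟨e, he, ⟨h1, h2⟩ | ⟨h1, h2⟩⟩ := h _ hpq
    · exact ⟨e.2, e.1, h2, h1, Or.inr he⟩
    · exact ⟨e.1, e.2, h2, h1, Or.inl he⟩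

theorem isMonotone_Q2 : Q2.IsMonotone := isMonotone_ofEdges (by decide)

theorem isMonotone_R5 : R5.IsMonotone := isMonotone_ofEdges (by decide)

theorem isMonotone_R8 : R8.IsMonotone := isMonotone_ofEdges (by decide)

theorem isMonotone_R7minus : R7minus.IsMonotone := isMonotone_ofEdges (by decide)

/-- An occurrence of a pattern given by lists of edges: four distinct variables, and values of
them. -/
theorem occursIn_ofEdges {n : ℕ} {var : Fin n → Fin 4} {pos neg : List (Fin n × Fin n)}
    {hpos hneg hdisj} (x : Fin 4 → X) (hx : Function.Injective x) (a : Fin n → D)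
    (hd : ∀ p, a p ∈ I.dom (x (var p)))
    (hp : ∀ e ∈ pos, I.rel (x (var e.1)) (x (var e.2)) (a e.1) (a e.2))
    (hn : ∀ e ∈ neg, ¬ I.rel (x (var e.1)) (x (var e.2)) (a e.1) (a e.2)) :
    (ofEdges var pos neg hpos hneg hdisj).OccursIn I := by
  refine ⟨fun p => x (var p), a, hd, fun p q => hx.eq_iff, fun p q h => ?_, fun p q h => ?_⟩
  · rcases h with h | h
    · exact hp _ h
    · exact (I.rel_comm (hx.ne (hpos _ h).symm)).2 (hp _ h)
  · rcases h with h | h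
    · exact hn _ h
    · exact fun hr => hn _ h ((I.rel_comm (hx.ne (hneg _ h).symm)).1 hr)

theorem injective_vecCons_four {x y z w : X} (h1 : x ≠ y) (h2 : x ≠ z) (h3 : x ≠ w) (h4 : y ≠ z)
    (h5 : y ≠ w) (h6 : z ≠ w) : Function.Injective ![x, y, z, w] := by
  intro i j h
  fin_cases i <;> fin_cases j <;> simp_all

theorem occursIn_Q1 {P V Q R : X} (hPV : P ≠ V) (hPQ : P ≠ Q) (hPR : P ≠ R) (hVQ : V ≠ Q)
    (hVR : V ≠ R) (hQR : Q ≠ R) {p a b c q r : D} (hp : p ∈ I.dom P) (ha : a ∈ I.dom V)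
    (hb : b ∈ I.dom V) (hc : c ∈ I.dom V) (hq : q ∈ I.dom Q) (hr : r ∈ I.dom R)
    (hpc : I.rel P V p c) (haq : I.rel V Q a q) (hbr : I.rel V R b r)
    (hpb : ¬ I.rel P V p b) (hcq : ¬ I.rel V Q c q) (har : ¬ I.rel V R a r) :
    Q1.OccursIn I := by
  refine occursIn_ofEdges _ (injective_vecCons_four hPV hPQ hPR hVQ hVR hQR) ![p, a, b, c, q, r]
    ?_ ?_ ?_
  · simp [Fin.forall_fin_succ, *]
  · simp [*]
  · simp [*]

theorem occursIn_Q2 {P V Q R : X} (hPV : P ≠ V) (hPQ : P ≠ Q) (hPR : P ≠ R) (hVQ : V ≠ Q)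
    (hVR : V ≠ R) (hQR : Q ≠ R) {p a b q r : D} (hp : p ∈ I.dom P) (ha : a ∈ I.dom V)
    (hb : b ∈ I.dom V) (hq : q ∈ I.dom Q) (hr : r ∈ I.dom R)
    (hpb : I.rel P V p b) (har : I.rel V R a r)
    (hpa : ¬ I.rel P V p a) (haq : ¬ I.rel V Q a q) (hbr : ¬ I.rel V R b r) :
    Q2.OccursIn I := by
  refine occursIn_ofEdges _ (injective_vecCons_four hPV hPQ hPR hVQ hVR hQR) ![p, a, b, q, r]
    ?_ ?_ ?_
  · simp [Fin.forall_fin_succ, *]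
  · simp [*]
  · simp [*]

theorem occursIn_R5 {P V W Q : X} (hPV : P ≠ V) (hPW : P ≠ W) (hPQ : P ≠ Q) (hVW : V ≠ W)
    (hVQ : V ≠ Q) (hWQ : W ≠ Q) {p a b c d q : D} (hp : p ∈ I.dom P) (ha : a ∈ I.dom V)
    (hb : b ∈ I.dom V) (hc : c ∈ I.dom W) (hd : d ∈ I.dom W) (hq : q ∈ I.dom Q)
    (hpa : I.rel P V p a) (had : I.rel V W a d) (hbc : I.rel V W b c) (hcq : I.rel W Q c q)
    (hpb : ¬ I.rel P V p b) (hac : ¬ I.rel V W a c) (hdq : ¬ I.rel W Q d q) :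
    R5.OccursIn I := by
  refine occursIn_ofEdges _ (injective_vecCons_four hPV hPW hPQ hVW hVQ hWQ) ![p, a, b, c, d, q]
    ?_ ?_ ?_
  · simp [Fin.forall_fin_succ, *]
  · simp [*]
  · simp [*]

theorem occursIn_R8 {P V W Q : X} (hPV : P ≠ V) (hPW : P ≠ W) (hPQ : P ≠ Q) (hVW : V ≠ W)
    (hVQ : V ≠ Q) (hWQ : W ≠ Q) {p a b e c d q : D} (hp : p ∈ I.dom P) (ha : a ∈ I.dom V)
    (hb : b ∈ I.dom V) (he : e ∈ I.dom V) (hc : c ∈ I.dom W) (hd : d ∈ I.dom W) (hq : q ∈ I.dom Q)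
    (hpa : I.rel P V p a) (hpe : I.rel P V p e) (had : I.rel V W a d) (hec : I.rel V W e c)
    (hcq : I.rel W Q c q)
    (hpb : ¬ I.rel P V p b) (hac : ¬ I.rel V W a c) (hdq : ¬ I.rel W Q d q) :
    R8.OccursIn I := by
  refine occursIn_ofEdges _ (injective_vecCons_four hPV hPW hPQ hVW hVQ hWQ)
    ![p, a, b, e, c, d, q] ?_ ?_ ?_
  · simp [Fin.forall_fin_succ, *]
  · simp [*]
  · simp [*]

theorem occursIn_R7minus {P V W Q : X} (hPV : P ≠ V) (hPW : P ≠ W) (hPQ : P ≠ Q) (hVW : V ≠ W)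
    (hVQ : V ≠ Q) (hWQ : W ≠ Q) {p a b c d e q : D} (hp : p ∈ I.dom P) (ha : a ∈ I.dom V)
    (hb : b ∈ I.dom V) (hc : c ∈ I.dom W) (hd : d ∈ I.dom W) (he : e ∈ I.dom W) (hq : q ∈ I.dom Q)
    (hpb : I.rel P V p b) (hbd : I.rel V W b d) (hbe : I.rel V W b e) (heq : I.rel W Q e q)
    (hpa : ¬ I.rel P V p a) (hbc : ¬ I.rel V W b c) (hdq : ¬ I.rel W Q d q) :
    R7minus.OccursIn I := by
  refine occursIn_ofEdges _ (injective_vecCons_four hPV hPW hPQ hVW hVQ hWQ)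
    ![p, a, b, c, d, e, q] ?_ ?_ ?_
  · simp [Fin.forall_fin_succ, *]
  · simp [*]
  · simp [*]

end Pattern

end BinaryCSP

/-! ### The patterns R5 and R8 -/

namespace BinaryCSP

open Set

namespace Pattern

variable {X : Type u} {D : Type v} {I : Instance X D}

/-- A solution `s` of the instance without the nontrivial constraint between `V` and `W` can be
repaired by changing one or two of its values. -/
theorem Admits.satisfiable_of_R5 [Finite X] [Finite D] (hI : R5.Admits I)
    (ih : R5.SolvesBelow I) : I.Satisfiable := by
  classical
  by_cases htriv : ∀ x y, x ≠ y → I.TrivialOn x y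
  · exact Instance.satisfiable_of_trivialOn hI.nonempty htriv
  push Not at htriv
  obtain ⟨V, W, hVW, hn⟩ := htriv
  have hT : ∀ z w, (z = V ∧ w = W ∨ z = W ∧ w = V) ↔ (w = V ∧ z = W ∨ w = W ∧ z = V) := by tauto
  obtain ⟨s, hs, hs'⟩ := ih (I.relax (fun z w => z = V ∧ w = W ∨ z = W ∧ w = V) hT)
    ⟨fun h => hI.avoids (h.of_relax isMonotone_R5), hI.sac.relax _ hT, hI.nonempty⟩
    (Instance.size_relax_lt _ hT hVW hn (Or.inl ⟨rfl, rfl⟩))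
  replace hs : ∀ x, s x ∈ I.dom x := hs
  replace hs' : ∀ x y, x ≠ y → ¬ (x = V ∧ y = W ∨ x = W ∧ y = V) → I.rel x y (s x) (s y) :=
    fun x y h hn => (hs' x y h).resolve_right hn
  -- a map differing from `s` only at `V` or only at `W` is a solution if the new value fits
  have upd : ∀ x c, (x = V ∨ x = W) → c ∈ I.dom x → (∀ y, x ≠ y → I.rel x y c (s y)) →
      I.Satisfiable := by
    refine fun x c hx hc h => Instance.satisfiable_of_update (fun y _ => hs y) hc h
      fun y z hy hz hyz => hs' y z hyz ?_
    rintro (⟨rfl, rfl⟩ | ⟨rfl, rfl⟩) <;> tauto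
  by_cases hac : I.rel V W (s V) (s W)
  · refine upd V (s V) (Or.inl rfl) (hs V) fun y hy => ?_
    by_cases hyW : y = W
    · subst hyW; exact hac
    · exact hs' V y hy (by tauto)
  obtain ⟨E, hE, hEV⟩ := hI.sac.exists_family (hs V)
  obtain ⟨d, hd⟩ := hE.nonempty W
  have had : I.rel V W (s V) d := hE.rel_of_singleton hVW hEV hd
  obtain ⟨b, hb, hcb⟩ := hI.sac.exists_support hVW.symm (hs W)
  have hbc : I.rel V W b (s W) := (I.rel_comm hVW).2 hcb
  by_cases hall : ∀ y, V ≠ y → I.rel V y b (s y)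
  · exact upd V b (Or.inl rfl) hb hall
  push Not at hall
  obtain ⟨P, hVP, hbP⟩ := hall
  have hWP : W ≠ P := by rintro rfl; exact hbP hbc
  have hdQ : ∀ Q, W ≠ Q → V ≠ Q → P ≠ Q → I.rel W Q d (s Q) := by
    intro Q hWQ hVQ hPQ
    by_contra hdq
    refine hI.avoids (occursIn_R5 hVP.symm hWP.symm hPQ hVW hVQ hWQ (hs P) (hs V) hb (hs W)
      (hE.subset W hd) (hs Q) (hs' _ _ hVP.symm (by tauto)) had hbc (hs' _ _ hWQ (by tauto))
      ?_ hac hdq)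
    exact fun h => hbP ((I.rel_comm hVP).2 h)
  by_cases hdP : I.rel W P d (s P)
  · refine upd W d (Or.inr rfl) (hE.subset W hd) fun y hy => ?_
    by_cases hyV : y = V
    · subst hyV; exact (I.rel_comm hVW).1 had
    · by_cases hyP : y = P
      · subst hyP; exact hdP
      · exact hdQ y hy (Ne.symm hyV) (Ne.symm hyP)
  -- `s P` conflicts with `d`, so it is replaced as well
  obtain ⟨p, hp, hdp⟩ := hE.support W P hWP d hd
  have hpV : I.rel V P (s V) p := hE.rel_of_singleton hVP hEV hp
  have hpQ : ∀ Q, W ≠ Q → V ≠ Q → P ≠ Q → I.rel P Q p (s Q) := by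
    intro Q hWQ hVQ hPQ
    by_contra hpq
    exact hI.avoids (occursIn_R5 hVW hVP hVQ hWP hWQ hPQ (hs V) (hE.subset W hd) (hs W) (hs P)
      (hE.subset P hp) (hs Q) had hdp (hs' _ _ hWP (by tauto)) (hs' _ _ hPQ (by tauto)) hac hdP
      hpq)
  have hsW : ∀ y, W ≠ y → P ≠ y → I.rel W y d (s y) := by
    intro y hy hPy
    by_cases hyV : V = y
    · subst hyV; exact (I.rel_comm hVW).1 had
    · exact hdQ y hy hyV hPy
  refine Instance.satisfiable_of_update (s := Function.update s W d) (x := P) (c := p)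
    (fun y _ => ?_) (hE.subset P hp) (fun y hy => ?_) fun y z hy hz hyz => ?_
  · by_cases hyW : y = W
    · subst hyW; simpa using hE.subset _ hd
    · simpa [hyW] using hs y
  · by_cases hyW : y = W
    · subst hyW; simpa using (I.rel_comm hWP).1 hdp
    · rw [Function.update_of_ne hyW]
      by_cases hyV : y = V
      · subst hyV; exact (I.rel_comm hVP).1 hpV
      · exact hpQ y (Ne.symm hyW) (Ne.symm hyV) hy
  · by_cases hyW : y = W
    · subst hyW
      simpa [hyz.symm] using hsW z hyz hz.symm
    · by_cases hzW : z = W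
      · subst hzW
        simpa [hyz] using (I.rel_comm hyz).2 (hsW y hyz.symm hy.symm)
      · rw [Function.update_of_ne hyW, Function.update_of_ne hzW]
        exact hs' y z hyz (by tauto)

/-- Once the trace has reached `w` from `z ∈ S`, an arbitrary value of `w` may be fixed: deleting
the values incompatible with it leaves an arc consistent family. -/
theorem Admits.satisfiable_of_R8 [Finite X] [Finite D] (hI : R8.Admits I)
    (ih : R8.SolvesBelow I) : I.Satisfiable := by
  classical
  by_cases htriv : ∀ x y, x ≠ y → I.TrivialOn x y
  · exact Instance.satisfiable_of_trivialOn hI.nonempty htriv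
  push Not at htriv
  obtain ⟨x, y, hxy, hn⟩ := htriv
  obtain ⟨v, hv⟩ := hI.nonempty x
  obtain ⟨E₀, hE₀, hx₀⟩ := hI.sac.exists_family hv
  obtain ⟨S, -, hS⟩ := (toFinite {S : Set X | x ∈ S ∧ ∃ s : X → D, ∃ E, I.IsACFamily E ∧
    ∀ z ∈ S, E z = {s z}}).exists_le_maximal (a := {x})
      ⟨rfl, fun _ => v, E₀, hE₀, by rintro _ rfl; exact hx₀⟩
  obtain ⟨⟨hxS, s, E, hE, hs⟩, hmax⟩ := hS
  refine hI.satisfiable_of_autark isMonotone_R8 ih (S := S) (s := s)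
    (fun z hz => hE.subset z (by simp [hs z hz]))
    (fun z hz w hw hzw => hE.rel_of_singleton hzw (hs z hz) (by simp [hs w hw]))
    ?_ hxS hxy hn
  intro z hz w hw
  by_contra hfull
  obtain ⟨b, hb, hzb⟩ := Instance.not_full.1 hfull
  have hzw : z ≠ w := by rintro rfl; exact hw hz
  obtain ⟨a, ha⟩ := hE.nonempty w
  have hza := fun u (hu : z ≠ u) e (he : e ∈ E u) => hE.rel_of_singleton hu (hs z hz) he
  set E' : X → Set D := fun u => {c | c ∈ E u ∧ (u = w → c = a) ∧ (u ≠ w → I.rel u w c a)}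
  have hE'w : E' w = {a} := by
    ext c
    exact ⟨fun h => h.2.1 rfl, fun h => ⟨h ▸ ha, fun _ => h, fun h => absurd rfl h⟩⟩
  have hsupp : ∀ u, u ≠ w → ∃ c ∈ E' u, I.rel u w c a := by
    intro u hu
    obtain ⟨c, hc, hac⟩ := hE.support w u hu.symm a ha
    have := (I.rel_comm hu).2 hac
    exact ⟨c, ⟨hc, fun h => absurd h hu, fun _ => this⟩, this⟩
  have hE' : I.IsACFamily E' := by
    refine ⟨fun u c hc => hE.subset u hc.1, fun u => ?_, fun u u' huu' c hc => ?_⟩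
    · by_cases hu : u = w
      · subst hu; rw [hE'w]; exact ⟨a, rfl⟩
      · obtain ⟨c, hc, -⟩ := hsupp u hu
        exact ⟨c, hc⟩
    · by_cases hu : u = w
      · subst hu
        rw [hE'w] at hc
        obtain rfl : c = a := hc
        obtain ⟨e, he, hea⟩ := hsupp u' huu'.symm
        exact ⟨e, he, (I.rel_comm huu').2 hea⟩
      by_cases hu' : u' = w
      · subst hu'
        exact ⟨a, by rw [hE'w]; rfl, hc.2.2 hu⟩
      obtain ⟨d, hd, hda⟩ := hsupp u' hu'
      by_cases hcd : I.rel u u' c d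
      · exact ⟨d, hd, hcd⟩
      obtain ⟨e, he, hce⟩ := hE.support u u' huu' c hc.1
      by_cases hea : I.rel u' w e a
      · exact ⟨e, ⟨he, fun h => absurd h hu', fun _ => hea⟩, hce⟩
      exfalso
      have hzu : z ≠ u := by
        rintro rfl
        have : c = s z := by simpa [hs z hz] using hc.1
        exact hcd (this ▸ hza u' huu' d hd.1)
      have hzu' : z ≠ u' := by
        rintro rfl
        have : e = s z := by simpa [hs z hz] using he
        exact hea (this ▸ hza w hzw a ha)
      obtain ⟨f, hf, hef⟩ := hE.support u' w hu' e he
      refine hI.avoids (occursIn_R8 hzw hzu' hzu (Ne.symm hu') (Ne.symm hu) huu'.symm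
        (p := s z) (a := a) (b := b) (e := f) (c := e) (d := d) (q := c)
        (hE.subset z (by simp [hs z hz])) (hE.subset w ha) hb (hE.subset w hf) (hE.subset u' he)
        (hE.subset u' hd.1) (hE.subset u hc.1) (hza w hzw a ha) (hza w hzw f hf)
        ((I.rel_comm hu').1 hda) ((I.rel_comm hu').1 hef) ((I.rel_comm huu').1 hce) hzb ?_ ?_)
      · exact fun h => hea ((I.rel_comm hu').2 h)
      · exact fun h => hcd ((I.rel_comm huu').2 h)
  refine hw (hmax (y := insert w S) ⟨mem_insert_of_mem _ hxS, Function.update s w a, E', hE', ?_⟩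
    (subset_insert _ _) (mem_insert _ _))
  intro u hu
  by_cases huw : u = w
  · subst huw; simpa using hE'w
  · have huS : u ∈ S := hu.resolve_left huw
    rw [Function.update_of_ne huw, ← (hE'.nonempty u).subset_singleton_iff]
    intro c hc
    have := hc.1
    rwa [hs u huS] at this

end Pattern

end BinaryCSP

/-! ### The pattern R7⁻ -/

namespace BinaryCSP

open Set

namespace Pattern

variable {X : Type u} {D : Type v} {I : Instance X D}

/-- No point of `Q` distinguishes between the values of `w` that are compatible with the value `c`
of `z`. -/
def UniformAt (I : Instance X D) (z : X) (c : D) (w Q : X) : Prop :=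
  ∀ q ∈ I.dom Q, ∀ d ∈ I.dom w, ∀ e ∈ I.dom w, I.rel z w c d → I.rel z w c e → I.rel w Q d q →
    I.rel w Q e q

/-- The value `c` of `z` is constrained by the value `p` of `P`: they are compatible, but `p` is
incompatible with some other value of `z`. -/
def PointsTo (I : Instance X D) (P : X) (p : D) (z : X) (c : D) : Prop :=
  p ∈ I.dom P ∧ I.rel P z p c ∧ ¬ I.Full P p z

/-- The form in which the absence of `R7minus` is used. -/
theorem uniformAt_of_avoids_R7minus (hI : ¬ R7minus.OccursIn I) {P z w Q : X} {p c : D}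
    (hPz : P ≠ z) (hPw : P ≠ w) (hPQ : P ≠ Q) (hzw : z ≠ w) (hzQ : z ≠ Q) (hwQ : w ≠ Q)
    (hc : c ∈ I.dom z) (hp : PointsTo I P p z c) (hcw : ¬ I.Full z c w) : UniformAt I z c w Q := by
  intro q hq d hd e he hcd hce hdq
  by_contra heq
  obtain ⟨hp, hpc, hpz⟩ := hp
  obtain ⟨a, ha, hpa⟩ := Instance.not_full.1 hpz
  obtain ⟨b, hb, hcb⟩ := Instance.not_full.1 hcw
  exact hI (occursIn_R7minus hPz hPw hPQ hzw hzQ hwQ hp ha hc hb he hd hq hpc hce hcd hdq hpa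
    hcb heq)

/-- The state of a trace: an arc consistent family in which the variables of `S` have single
values `s z`; moreover each value `s z` is constrained by a value of some other variable in `S`
or no point splits the sets of values to which `s z` restricts other variables. -/
structure IsR7Trace (I : Instance X D) (S : Set X) (s : X → D) (E : X → Set D) : Prop where
  family : I.IsACFamily E
  single : ∀ z ∈ S, E z = {s z}
  parent : ∀ z ∈ S, (∃ P ∈ S, P ≠ z ∧ ∃ p, PointsTo I P p z (s z)) ∨
    ∀ w Q, z ≠ w → z ≠ Q → w ≠ Q → ¬ I.Full z (s z) w → UniformAt I z (s z) w Q

/-- If `s z`, `z ∈ S`, restricts a variable `w ∉ S`, then the values left for `w` are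
indistinguishable for the variables outside `S`, so that any one of them may be fixed. -/
theorem IsR7Trace.exists_insert (hI : ¬ R7minus.OccursIn I) {S : Set X} {s : X → D}
    {E : X → Set D} (h : IsR7Trace I S s E) {z w : X} (hz : z ∈ S) (hw : w ∉ S)
    (hzw : ¬ I.Full z (s z) w) : ∃ s' E', IsR7Trace I (insert w S) s' E' := by
  classical
  have hne : ∀ u ∈ S, u ≠ w := fun u hu h => hw (h ▸ hu)
  obtain ⟨a, ha⟩ := h.family.nonempty w
  have hdom : ∀ u ∈ S, s u ∈ I.dom u := fun u hu => h.family.subset u (by simp [h.single u hu])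
  have hE : ∀ u ∈ S, u ≠ w → ∀ e ∈ E w, I.rel u w (s u) e := fun u hu huw e he =>
    h.family.rel_of_singleton huw (h.single u hu) he
  have huni : ∀ Q, Q ∉ S → w ≠ Q → UniformAt I z (s z) w Q := by
    intro Q hQ hwQ
    have hzQ : z ≠ Q := fun h => hQ (h ▸ hz)
    rcases h.parent z hz with ⟨P, hP, hPz, p, hp⟩ | h'
    · exact uniformAt_of_avoids_R7minus hI hPz (hne P hP) (fun h => hQ (h ▸ hP)) (hne z hz) hzQ hwQ
        (hdom z hz) hp hzw
    · exact h' w Q (hne z hz) hzQ hwQ hzw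
  have hwa : ∀ u, u ≠ w → ∀ e ∈ E u, I.rel u w e a := by
    intro u huw e he
    by_cases hu : u ∈ S
    · have : e = s u := by simpa [h.single u hu] using he
      exact this ▸ hE u hu huw a ha
    · obtain ⟨b, hb, heb⟩ := h.family.support u w huw e he
      rw [I.rel_comm huw] at heb ⊢
      exact huni u hu (Ne.symm huw) e (h.family.subset u he) b (h.family.subset w hb) a
        (h.family.subset w ha) (hE z hz (hne z hz) b hb) (hE z hz (hne z hz) a ha) heb
  refine ⟨Function.update s w a, Function.update E w {a}, ⟨fun u => ?_, fun u => ?_, ?_⟩,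
    fun u hu => ?_, fun u hu => ?_⟩
  · by_cases huw : u = w
    · subst huw; simpa using h.family.subset u ha
    · simpa [huw] using h.family.subset u
  · by_cases huw : u = w
    · subst huw; simp
    · simpa [huw] using h.family.nonempty u
  · intro u u' huu' e he
    by_cases huw : u = w
    · subst huw
      obtain rfl : e = a := by simpa using he
      simpa [huu'.symm] using h.family.support u u' huu' e ha
    · rw [Function.update_of_ne huw] at he
      by_cases huw' : u' = w
      · subst huw'
        simpa using hwa u huu' e he
      · simpa [huw'] using h.family.support u u' huu' e he
  · by_cases huw : u = w
    · subst huw; simp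
    · simpa [huw] using h.single u (hu.resolve_left huw)
  · by_cases huw : u = w
    · subst huw
      refine Or.inl ⟨z, mem_insert_of_mem _ hz, hne z hz, s z, hdom z hz, ?_, hzw⟩
      simpa using hE z hz (hne z hz) a ha
    · rw [Function.update_of_ne huw]
      rcases h.parent u (hu.resolve_left huw) with ⟨P, hP, h'⟩ | h'
      · exact Or.inl ⟨P, mem_insert_of_mem _ hP, h'⟩
      · exact Or.inr h'

/-- A maximal trace is closed, so the constraints at its variables may be deleted. -/
theorem Admits.satisfiable_of_isR7Trace [Finite X] (hI : R7minus.Admits I)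
    (ih : R7minus.SolvesBelow I) {S : Set X} {s : X → D} {E : X → Set D}
    (h : IsR7Trace I S s E) {x y : X} (hx : x ∈ S) (hxy : x ≠ y) (hn : ¬ I.TrivialOn x y) :
    I.Satisfiable := by
  obtain ⟨T, hST, hT⟩ := (toFinite {S : Set X | ∃ s E, IsR7Trace I S s E}).exists_le_maximal
    (a := S) ⟨s, E, h⟩
  obtain ⟨⟨t, F, hF⟩, hmax⟩ := hT
  refine hI.satisfiable_of_autark isMonotone_R7minus ih (S := T) (s := t)
    (fun z hz => hF.family.subset z (by simp [hF.single z hz]))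
    (fun z hz w hw hzw => hF.family.rel_of_singleton hzw (hF.single z hz) (by simp [hF.single w hw]))
    (fun z hz w hw => ?_) (hST hx) hxy hn
  by_contra hfull
  exact hw (hmax (hF.exists_insert hI.avoids hz hw hfull) (subset_insert _ _) (mem_insert _ _))

/-- The state of the auxiliary trace used for a pair of values `p` of `P` and `b` of `y`
constraining each other: its values are taken from the family `E` (of `p`), while the variables
not yet reached keep the values of the family `F` (of `b`). Each value is constrained by one of
smaller rank. -/
structure IsSideTrace (I : Instance X D) (P y : X) (b : D) (E F : X → Set D) (S : Set X)
    (s : X → D) (r : X → ℕ) : Prop where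
  root_mem : y ∈ S
  root_eq : s y = b
  notMem : P ∉ S
  mem : ∀ z ∈ S, s z ∈ E z
  rel : ∀ z ∈ S, ∀ w ∈ S, z ≠ w → I.rel z w (s z) (s w)
  rel_family : ∀ z ∈ S, ∀ w ∉ S, w ≠ P → ∀ e ∈ F w, I.rel z w (s z) e
  parent : ∀ z ∈ S, z ≠ y → ∃ u ∈ S, u ≠ z ∧ r u < r z ∧ ¬ I.Full u (s u) z

/-- A side trace that restricts a variable outside `S` other than `P` grows by that variable. The
new value is compatible with the old ones because `b` has the arc consistent family `F`, in which
the values left for `w` fit the old ones. -/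
theorem IsSideTrace.exists_insert (hI : ¬ R7minus.OccursIn I) {P y : X} {p b : D} {E F : X → Set D}
    (hE : I.IsACFamily E) (hF : I.IsACFamily F) (hpb : PointsTo I P p y b)
    {S : Set X} {s : X → D} {r : X → ℕ}
    (h : IsSideTrace I P y b E F S s r) {w : X} (hw : w ∉ S) (hwP : w ≠ P)
    (hopen : ∃ z ∈ S, ¬ I.Full z (s z) w) : ∃ s' r', IsSideTrace I P y b E F (insert w S) s' r' := by
  classical
  -- `z` is chosen of minimal rank, so that its parent does not restrict `w`
  obtain ⟨z, ⟨hz, hzw⟩, hmin⟩ := exists_minimalFor_of_wellFoundedLT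
    (fun z => z ∈ S ∧ ¬ I.Full z (s z) w) r hopen
  have hne : ∀ u ∈ S, u ≠ w := fun u hu h => hw (h ▸ hu)
  have hneP : ∀ u ∈ S, u ≠ P := fun u hu h' => h.notMem (h' ▸ hu)
  obtain ⟨a, ha, hza⟩ := hE.support z w (hne z hz) _ (h.mem z hz)
  have hpar : ∃ U, (U ∈ S ∨ U = P) ∧ U ≠ z ∧ U ≠ w ∧ (∃ c, PointsTo I U c z (s z)) ∧
      (U ∈ S → I.Full U (s U) w) := by
    by_cases hzy : z = y
    · subst hzy
      exact ⟨P, Or.inr rfl, (hneP _ hz).symm, hwP.symm, ⟨p, h.root_eq ▸ hpb⟩,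
        fun hP => (h.notMem hP).elim⟩
    · obtain ⟨U, hU, hUz, hr, hfull⟩ := h.parent z hz hzy
      refine ⟨U, Or.inl hU, hUz, hne U hU,
        ⟨s U, hE.subset U (h.mem U hU), h.rel U hU z hz hUz, hfull⟩, fun _ => ?_⟩
      by_contra hUw
      exact absurd (hmin ⟨hU, hUw⟩ hr.le) (by omega)
  obtain ⟨U, hUS, hUz, hUw, ⟨c, hc⟩, hUfull⟩ := hpar
  have huni : ∀ Q, Q ≠ U → Q ≠ z → Q ≠ w → UniformAt I z (s z) w Q := fun Q hQU hQz hQw =>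
    uniformAt_of_avoids_R7minus hI hUz hUw (Ne.symm hQU) (hne z hz) (Ne.symm hQz) (Ne.symm hQw)
      (hE.subset z (h.mem z hz)) hc hzw
  have hold : ∀ u ∈ S, I.rel u w (s u) a := by
    intro u hu
    by_cases huz : u = z
    · exact huz ▸ hza
    by_cases huU : u = U
    · subst huU
      exact hUfull hu a (hE.subset w ha)
    obtain ⟨f, hf⟩ := hF.nonempty w
    rw [I.rel_comm (hne u hu)]
    exact huni u huU huz (hne u hu) _ (hE.subset u (h.mem u hu)) f (hF.subset w hf) a
      (hE.subset w ha) (h.rel_family z hz w hw hwP f hf) hza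
      ((I.rel_comm (hne u hu)).1 (h.rel_family u hu w hw hwP f hf))
  have hnew : ∀ w' ∉ insert w S, w' ≠ P → ∀ e ∈ F w', I.rel w w' a e := by
    intro w' hw' hw'P e he
    rw [mem_insert_iff, not_or] at hw'
    obtain ⟨f, hf, hef⟩ := hF.support w' w hw'.1 e he
    refine huni w' ?_ (fun h => hw'.2 (h ▸ hz)) hw'.1 e (hF.subset w' he) f (hF.subset w hf) a
      (hE.subset w ha) (h.rel_family z hz w hw hwP f hf) hza ((I.rel_comm hw'.1).1 hef)
    rintro rfl
    exact hUS.elim hw'.2 hw'P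
  refine ⟨Function.update s w a, Function.update r w (r z + 1), mem_insert_of_mem _ h.root_mem,
    ?_, ?_, fun u hu => ?_, fun u hu u' hu' huu' => ?_, fun u hu u' hu' hu'P e he => ?_,
    fun u hu huy => ?_⟩
  · rw [Function.update_of_ne (hne y h.root_mem), h.root_eq]
  · rintro (h' | h')
    · exact hwP h'.symm
    · exact h.notMem h'
  · by_cases huw : u = w
    · subst huw; simpa using ha
    · simpa [huw] using h.mem u (hu.resolve_left huw)
  · by_cases huw : u = w
    · subst huw
      simpa [huu'.symm] using (I.rel_comm huu').2 (hold u' (hu'.resolve_left huu'.symm))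
    · have huS := hu.resolve_left huw
      by_cases hu'w : u' = w
      · subst hu'w
        simpa [huu'] using hold u huS
      · simpa [huw, hu'w] using h.rel u huS u' (hu'.resolve_left hu'w) huu'
  · by_cases huw : u = w
    · subst huw
      simpa using hnew u' hu' hu'P e he
    · simpa [huw] using h.rel_family u (hu.resolve_left huw) u' (fun h => hu' (Or.inr h)) hu'P e he
  · by_cases huw : u = w
    · subst huw
      exact ⟨z, mem_insert_of_mem _ hz, hne z hz, by simp [hne z hz], by simpa [hne z hz] using hzw⟩
    · obtain ⟨U', hU', h1, h2, h3⟩ := h.parent u (hu.resolve_left huw) huy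
      exact ⟨U', mem_insert_of_mem _ hU', h1, by simpa [huw, hne U' hU'] using h2,
        by simpa [hne U' hU'] using h3⟩

/-- Two values `p` of `P` and `b₀` of `y` that constrain each other yield a trace in which every
value is constrained from within the trace. -/
theorem Admits.satisfiable_of_pointsTo [Finite X] (hI : R7minus.Admits I)
    (ih : R7minus.SolvesBelow I) {P y : X} (hPy : P ≠ y) {p b₀ : D} (hp : PointsTo I P p y b₀)
    (hb₀ : PointsTo I y b₀ P p) : I.Satisfiable := by
  classical
  obtain ⟨E, hE, hEP⟩ := hI.sac.exists_family hp.1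
  obtain ⟨b, hb⟩ := hE.nonempty y
  have hpE : ∀ u, P ≠ u → ∀ e ∈ E u, I.rel P u p e := fun u hu e he =>
    hE.rel_of_singleton hu hEP he
  have hpb : PointsTo I P p y b := ⟨hp.1, hpE y hPy b hb, hp.2.2⟩
  obtain ⟨F, hF, hFy⟩ := hI.sac.exists_family (hE.subset y hb)
  have h₀ : IsSideTrace I P y b E F {y} (fun _ => b) (fun _ => 0) := by
    refine ⟨rfl, rfl, hPy, ?_, ?_, ?_, ?_⟩
    · rintro _ rfl; exact hb
    · rintro _ rfl _ rfl h; exact (h rfl).elim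
    · rintro _ rfl w hw - e he
      exact hF.rel_of_singleton (Ne.symm hw) hFy he
    · rintro _ rfl h; exact (h rfl).elim
  obtain ⟨S, -, ⟨s, r, hS⟩, hmax⟩ :=
    (toFinite {S : Set X | ∃ s r, IsSideTrace I P y b E F S s r}).exists_le_maximal (a := {y})
      ⟨_, _, h₀⟩
  have hclosed : ∀ z ∈ S, ∀ w ∉ S, w ≠ P → I.Full z (s z) w := by
    intro z hz w hw hwP
    by_contra hfull
    exact hw (hmax (hS.exists_insert hI.avoids hE hF hpb hw hwP ⟨z, hz, hfull⟩) (subset_insert _ _)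
      (mem_insert _ _))
  have hneP : ∀ u ∈ S, u ≠ P := fun u hu h' => hS.notMem (h' ▸ hu)
  have hsdom : ∀ u ∈ S, s u ∈ I.dom u := fun u hu => hE.subset u (hS.mem u hu)
  refine hI.satisfiable_of_isR7Trace ih (S := insert P S) (s := Function.update s P p)
    (E := fun u => if u ∈ S then {s u} else E u) ⟨⟨fun u => ?_, fun u => ?_, ?_⟩, ?_, ?_⟩
    (mem_insert _ _) hPy fun h => hp.2.2 (h p hp.1)
  · by_cases hu : u ∈ S
    · simpa [hu] using hsdom u hu
    · simpa [hu] using hE.subset u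
  · by_cases hu : u ∈ S
    · simp [hu]
    · simpa [hu] using hE.nonempty u
  · intro u u' huu' e he
    by_cases hu : u ∈ S <;> by_cases hu' : u' ∈ S <;>
      simp only [hu, hu', if_true, if_false] at he ⊢
    · exact ⟨s u', rfl, he ▸ hS.rel u hu u' hu' huu'⟩
    · obtain rfl : e = s u := he
      exact hE.support u u' huu' _ (hS.mem u hu)
    · refine ⟨s u', rfl, ?_⟩
      by_cases huP : u = P
      · subst huP
        obtain rfl : e = p := by rwa [hEP] at he
        exact hpE u' huu' _ (hS.mem u' hu')
      · exact (I.rel_comm huu').2 (hclosed u' hu' u hu huP e (hE.subset u he))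
    · exact hE.support u u' huu' e he
  · intro u hu
    by_cases huP : u = P
    · subst huP; simpa [hS.notMem] using hEP
    · simp [huP, hu.resolve_left huP]
  · intro u hu
    left
    by_cases huP : u = P
    · subst huP
      exact ⟨y, mem_insert_of_mem _ hS.root_mem, hPy.symm, b₀, by simpa using hb₀⟩
    · have huS := hu.resolve_left huP
      rw [Function.update_of_ne huP]
      by_cases huy : u = y
      · subst huy
        exact ⟨P, mem_insert _ _, hPy, p, hS.root_eq ▸ hpb⟩
      · obtain ⟨U, hU, hUu, -, hfull⟩ := hS.parent u huS huy
        exact ⟨U, mem_insert_of_mem _ hU, hUu, s U, hsdom U hU, hS.rel U hU u huS hUu, hfull⟩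

/-- Unless two values constrain each other, a value constrained by two different variables restricts
other variables to indistinguishable values, so that it is the root of a trace; and if no value is
constrained by two variables, the same holds for all values. -/
theorem Admits.satisfiable_of_R7minus [Finite X] [Finite D] (hI : R7minus.Admits I)
    (ih : R7minus.SolvesBelow I) : I.Satisfiable := by
  by_cases htriv : ∀ x y, x ≠ y → I.TrivialOn x y
  · exact Instance.satisfiable_of_trivialOn hI.nonempty htriv
  by_cases hmut : ∃ P y p b, P ≠ y ∧ PointsTo I P p y b ∧ PointsTo I y b P p
  · obtain ⟨P, y, p, b, hPy, hp, hb⟩ := hmut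
    exact hI.satisfiable_of_pointsTo ih hPy hp hb
  have hfull : ∀ {P y p b}, P ≠ y → b ∈ I.dom y → PointsTo I P p y b → I.Full y b P := by
    intro P y p b hPy hb hp
    by_contra h
    exact hmut ⟨P, y, p, b, hPy, hp, hb, (I.rel_comm hPy).1 hp.2.1, h⟩
  have root : ∀ y b, b ∈ I.dom y → (∀ w Q, y ≠ w → y ≠ Q → w ≠ Q → ¬ I.Full y b w →
      UniformAt I y b w Q) → (∃ x, y ≠ x ∧ ¬ I.TrivialOn y x) → I.Satisfiable := by
    rintro y b hb huni ⟨x, hyx, hn⟩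
    obtain ⟨E, hE, hEy⟩ := hI.sac.exists_family hb
    refine hI.satisfiable_of_isR7Trace ih (S := {y}) (s := fun _ => b) (E := E)
      ⟨hE, ?_, ?_⟩ rfl hyx hn
    · rintro _ rfl; exact hEy
    · rintro _ rfl; exact Or.inr huni
  -- a value constrained by two variables is a root of a trace
  by_cases htwo : ∃ y b P P' p p', b ∈ I.dom y ∧ P ≠ P' ∧ P ≠ y ∧ P' ≠ y ∧ PointsTo I P p y b ∧
      PointsTo I P' p' y b
  · obtain ⟨y, b, P, P', p, p', hb, hPP', hP, hP', hp, hp'⟩ := htwo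
    refine root y b hb (fun w Q hyw hyQ hwQ hw => ?_) ⟨P, hP.symm, fun h => ?_⟩
    · have hPw : P ≠ w := by rintro rfl; exact hw (hfull hP hb hp)
      have hPw' : P' ≠ w := by rintro rfl; exact hw (hfull hP' hb hp')
      by_cases hPQ : P = Q
      · exact uniformAt_of_avoids_R7minus hI.avoids hP' hPw' (fun h => hPP' (hPQ.trans h.symm)) hyw
          hyQ hwQ hb hp' hw
      · exact uniformAt_of_avoids_R7minus hI.avoids hP hPw hPQ hyw hyQ hwQ hb hp hw
    · exact hp.2.2 fun c hc => (I.rel_comm hP).2 (h c hc p hp.1)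
  -- otherwise every value is one: a point splitting the values left for `w` would give a value of
  -- `w` constrained by two variables
  push Not at htriv
  obtain ⟨y, x, hyx, hn⟩ := htriv
  obtain ⟨b, hb⟩ := hI.nonempty y
  refine root y b hb (fun w Q hyw hyQ hwQ hw => ?_) ⟨x, hyx, hn⟩
  intro q hq d hd e he hbd hbe hdq
  by_contra heq
  exact htwo ⟨w, d, y, Q, b, q, hd, hyQ, hyw, hwQ.symm, ⟨hb, hbd, hw⟩,
    ⟨hq, (I.rel_comm hwQ).1 hdq, fun h => heq ((I.rel_comm hwQ).2 (h e he))⟩⟩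

end Pattern

end BinaryCSP

/-! ### Preferences between values, and the pattern Q2 -/

namespace BinaryCSP

open Set

namespace Pattern

variable {X : Type u} {D : Type v} {I : Instance X D}

/-- The variables that distinguish the values `a` and `b` of `V` in favour of `a`: they have a
value compatible with `a` but not with `b`. -/
def prefers (I : Instance X D) (V : X) (a b : D) : Set X :=
  {P | V ≠ P ∧ ∃ p ∈ I.dom P, I.rel V P a p ∧ ¬ I.rel V P b p}

theorem prefers_subset_union (V : X) (a b c : D) :
    prefers I V a b ⊆ prefers I V a c ∪ prefers I V c b := by
  rintro P ⟨hP, p, hp, ha, hb⟩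
  by_cases hc : I.rel V P c p
  · exact Or.inr ⟨hP, p, hp, hc, hb⟩
  · exact Or.inl ⟨hP, p, hp, ha, hc⟩

theorem prefers_self (V : X) (a : D) : prefers I V a a = ∅ := by
  ext P
  simp only [prefers]
  constructor
  · rintro ⟨-, p, -, h, h'⟩
    exact h' h
  · exact False.elim

/-- Unless a value can be removed by neighbourhood substitution, each value of a variable is
preferred to each other one by some variable. -/
theorem Admits.satisfiable_or_prefers_nonempty [Finite X] [Finite D] {P : Pattern}
    (hI : P.Admits I) (ih : P.SolvesBelow I) : I.Satisfiable ∨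
      ∀ V, ∀ a ∈ I.dom V, ∀ b ∈ I.dom V, a ≠ b → (prefers I V a b).Nonempty := by
  by_contra! h
  obtain ⟨hs, V, a, ha, b, hb, hab, h⟩ := h
  refine hs (hI.satisfiable_of_dominated ih hb ha hab.symm fun y hVy c hc hac => ?_)
  by_contra hbc
  exact eq_empty_iff_forall_notMem.1 h y ⟨hVy, c, hc, hac, hbc⟩

/-- If different variables prefer `b` to `a` and `a` to `b`, then `a` is compatible with all values
of all other variables. -/
theorem full_of_avoids_Q2 (hI : ¬ Q2.OccursIn I) {V P R : X} {a b : D} (ha : a ∈ I.dom V)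
    (hb : b ∈ I.dom V) (hP : P ∈ prefers I V b a) (hR : R ∈ prefers I V a b) (hPR : P ≠ R) {Q : X}
    (hVQ : V ≠ Q) (hQP : Q ≠ P) (hQR : Q ≠ R) : I.Full V a Q := by
  intro q hq
  by_contra haq
  obtain ⟨hVP, p, hp, hbp, hap⟩ := hP
  obtain ⟨hVR, r, hr, har, hbr⟩ := hR
  exact hI (occursIn_Q2 hVP.symm hQP.symm hPR hVQ hVR hQR hp ha hb hq hr
    ((I.rel_comm hVP).1 hbp) har (fun h => hap ((I.rel_comm hVP).2 h)) haq hbr)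

/-- In the absence of `Q2` and of dominated values, a value constrained by a value of `U` is
incompatible with values of at most one variable other than `U`. -/
theorem eq_of_not_full_of_avoids_Q2 (hI : Q2.Admits I)
    (hpref : ∀ V, ∀ a ∈ I.dom V, ∀ b ∈ I.dom V, a ≠ b → (prefers I V a b).Nonempty)
    {U V Q Q' : X} {c a : D} (hUV : U ≠ V) (ha : a ∈ I.dom V)
    (hca : PointsTo I U c V a) (hVQ : V ≠ Q) (hVQ' : V ≠ Q') (hQ : ¬ I.Full V a Q)
    (hQ' : ¬ I.Full V a Q') (hQU : Q ≠ U) (hQ'U : Q' ≠ U) : Q = Q' := by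
  by_contra hQQ'
  obtain ⟨hc, hca, hcV⟩ := hca
  obtain ⟨b, hb, hcb⟩ := Instance.not_full.1 hcV
  have hU : U ∈ prefers I V a b :=
    ⟨hUV.symm, c, hc, (I.rel_comm hUV).1 hca, fun h => hcb ((I.rel_comm hUV).2 h)⟩
  have hab : a ≠ b := by rintro rfl; exact hcb hca
  -- `a` and `b` are distinguished by `U` only
  have hba : ∀ R ∈ prefers I V b a, ∀ P ∈ prefers I V a b, R = P := by
    intro R hR P hP
    by_contra hRP
    obtain ⟨T, hT⟩ : ∃ T, ∀ S, V ≠ S → ¬ I.Full V a S → S ≠ U → S = T := by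
      by_cases hRU : R = U
      · refine ⟨P, fun S hVS hS hSU => ?_⟩
        by_contra hSP
        exact hS (full_of_avoids_Q2 hI.avoids ha hb hR hP hRP hVS (hRU ▸ hSU) hSP)
      · refine ⟨R, fun S hVS hS hSU => ?_⟩
        by_contra hSR
        exact hS (full_of_avoids_Q2 hI.avoids ha hb hR hU hRU hVS hSR hSU)
    exact hQQ' ((hT Q hVQ hQ hQU).trans (hT Q' hVQ' hQ' hQ'U).symm)
  have hbaU : prefers I V b a = {U} := by
    obtain ⟨R, hR⟩ := hpref V b hb a ha hab.symm
    refine Set.ext fun S => ⟨fun hS => hba S hS U hU, ?_⟩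
    rintro rfl
    exact hba R hR S hU ▸ hR
  have habU : ∀ S ∈ prefers I V a b, S = U := fun S hS =>
    (hba U (hbaU ▸ rfl) S hS).symm
  have haU : ¬ I.Full V a U := by
    have : U ∈ prefers I V b a := hbaU ▸ rfl
    obtain ⟨-, u, hu, -, hau⟩ := this
    exact fun h => hau (h u hu)
  have hagree : ∀ S, V ≠ S → S ≠ U → ∀ e ∈ I.dom S, (I.rel V S a e ↔ I.rel V S b e) := by
    intro S hVS hSU e he
    constructor
    · intro h
      by_contra h'
      exact hSU (habU S ⟨hVS, e, he, h, h'⟩)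
    · intro h
      by_contra h'
      have : S ∈ prefers I V b a := ⟨hVS, e, he, h, h'⟩
      rw [hbaU] at this
      exact hSU this
  -- a value `d` distinguished from `a` by `Q`
  obtain ⟨q, hq, haq⟩ := Instance.not_full.1 hQ
  obtain ⟨d, hd, hqd⟩ := hI.sac.exists_support hVQ.symm hq
  have hda : Q ∈ prefers I V d a := ⟨hVQ, q, hq, (I.rel_comm hVQ).2 hqd, haq⟩
  have hdb : Q ∈ prefers I V d b :=
    ⟨hVQ, q, hq, (I.rel_comm hVQ).2 hqd, fun h => haq ((hagree Q hVQ hQU q hq).2 h)⟩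
  have hadne : a ≠ d := by rintro rfl; exact haq ((I.rel_comm hVQ).2 hqd)
  have hadQ : ∀ S ∈ prefers I V a d, S = Q := by
    intro S hS
    by_contra hSQ
    by_cases hSU : S = U
    · subst hSU
      exact hQ' (full_of_avoids_Q2 hI.avoids ha hd hda hS (Ne.symm hSQ) hVQ' (Ne.symm hQQ') hQ'U)
    · exact haU (full_of_avoids_Q2 hI.avoids ha hd hda hS (Ne.symm hSQ) hUV.symm hQU.symm
        (Ne.symm hSU))
  have hbd : U ∈ prefers I V b d := by
    have h : U ∈ prefers I V b a := hbaU ▸ rfl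
    refine (prefers_subset_union V b a d h).resolve_right ?_
    rintro ⟨-, e, he, hde, hae⟩
    -- otherwise `d` is preferred to `a` by two variables
    obtain ⟨S, hS⟩ := hpref V a ha d hd hadne
    obtain rfl := hadQ S hS
    exact hQ' (full_of_avoids_Q2 hI.avoids ha hd ⟨hUV.symm, e, he, hde, hae⟩ hS hQU.symm hVQ' hQ'U
      (Ne.symm hQQ'))
  obtain ⟨q', hq', haq'⟩ := Instance.not_full.1 hQ'
  exact haq' ((hagree Q' hVQ' hQ'U q' hq').2 (full_of_avoids_Q2 hI.avoids hb hd hdb hbd hQU hVQ'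
    (Ne.symm hQQ') hQ'U q' hq'))

/-- The state of a trace that grows along paths starting at the root `x`: all its values other than
those of `x` and of the tip `t` of the last path are compatible with everything outside `S`. -/
structure IsPathTrace (I : Instance X D) (E : X → Set D) (x : X) (S : Set X) (s : X → D) (t : X) :
    Prop where
  root_mem : x ∈ S
  mem : ∀ z ∈ S, s z ∈ E z
  rel : ∀ z ∈ S, ∀ w ∈ S, z ≠ w → I.rel z w (s z) (s w)
  full : ∀ z ∈ S, z ≠ x → z ≠ t → ∀ w ∉ S, I.Full z (s z) w
  tip_mem : t ∈ S
  tip : t ≠ x → ∃ u ∈ S, u ≠ t ∧ ¬ I.Full u (s u) t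

/-- A path trace that is not closed grows by one variable, which becomes the tip: by
`eq_of_not_full_of_avoids_Q2` the former tip restricts at most that variable outside `S`. -/
theorem IsPathTrace.exists_insert (hI : Q2.Admits I)
    (hpref : ∀ V, ∀ a ∈ I.dom V, ∀ b ∈ I.dom V, a ≠ b → (prefers I V a b).Nonempty)
    {E : X → Set D} (hE : I.IsACFamily E) {x : X} {v : D} (hEx : E x = {v}) {S : Set X} {s : X → D}
    {t : X} (h : IsPathTrace I E x S s t) (hopen : ∃ z ∈ S, ∃ w ∉ S, ¬ I.Full z (s z) w) :
    ∃ w ∉ S, ∃ s', IsPathTrace I E x (insert w S) s' w := by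
  classical
  have hsx : s x = v := by simpa [hEx] using h.mem x h.root_mem
  -- the tip is continued if possible; otherwise a new path starts at the root
  obtain ⟨z, hz, w, hw, hzw, hztip⟩ : ∃ z ∈ S, ∃ w ∉ S, ¬ I.Full z (s z) w ∧
      (z = t ∨ z = x ∧ ∀ w ∉ S, I.Full t (s t) w) := by
    by_cases ht : ∀ w ∉ S, I.Full t (s t) w
    · obtain ⟨z, hz, w, hw, hzw⟩ := hopen
      refine ⟨z, hz, w, hw, hzw, Or.inr ⟨?_, ht⟩⟩
      by_contra hzx
      exact hzw (h.full z hz hzx (by rintro rfl; exact hzw (ht w hw)) w hw)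
    · push Not at ht
      obtain ⟨w, hw, htw⟩ := ht
      exact ⟨t, h.tip_mem, w, hw, htw, Or.inl rfl⟩
  have hne : ∀ u ∈ S, u ≠ w := fun u hu h => hw (h ▸ hu)
  obtain ⟨a, ha, hza⟩ := hE.support z w (hne z hz) _ (h.mem z hz)
  have hold : ∀ u ∈ S, I.rel u w (s u) a := by
    intro u hu
    by_cases huz : u = z
    · exact huz ▸ hza
    by_cases hux : u = x
    · subst hux
      exact hsx ▸ hE.rel_of_singleton (hne u hu) hEx ha
    by_cases hut : u = t
    · subst hut
      exact (hztip.resolve_left (Ne.symm huz)).2 w hw a (hE.subset w ha)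
    · exact h.full u hu hux hut w hw a (hE.subset w ha)
  refine ⟨w, hw, Function.update s w a, mem_insert_of_mem _ h.root_mem, fun u hu => ?_,
    fun u hu u' hu' huu' => ?_, fun u hu hux huw w' hw' => ?_, mem_insert _ _, fun _ =>
      ⟨z, mem_insert_of_mem _ hz, hne z hz, by simpa [hne z hz] using hzw⟩⟩
  · by_cases huw : u = w
    · subst huw; simpa using ha
    · simpa [huw] using h.mem u (hu.resolve_left huw)
  · by_cases huw : u = w
    · subst huw
      simpa [huu'.symm] using (I.rel_comm huu').2 (hold u' (hu'.resolve_left huu'.symm))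
    · have huS := hu.resolve_left huw
      by_cases hu'w : u' = w
      · subst hu'w
        simpa [huu'] using hold u huS
      · simpa [huw, hu'w] using h.rel u huS u' (hu'.resolve_left hu'w) huu'
  · rw [Function.update_of_ne huw]
    rw [mem_insert_iff, not_or] at hw'
    have huS := hu.resolve_left huw
    by_cases hut : u = t
    · subst hut
      rcases hztip with rfl | hztip
      · obtain ⟨U, hU, hUz, hfull⟩ := h.tip hux
        by_contra hzw'
        exact hw'.1 (eq_of_not_full_of_avoids_Q2 hI hpref hUz (hE.subset z (h.mem z hz))
          ⟨hE.subset U (h.mem U hU), h.rel U hU z hz hUz, hfull⟩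
          (fun h => hw'.2 (h ▸ hz)) (hne z hz) hzw' hzw (fun h => hw'.2 (h ▸ hU)) (hne U hU).symm)
      · exact hztip.2 w' hw'.2
    · exact h.full u huS hux hut w' hw'.2

theorem Admits.satisfiable_of_Q2 [Finite X] [Finite D] (hI : Q2.Admits I)
    (ih : Q2.SolvesBelow I) : I.Satisfiable := by
  by_cases htriv : ∀ x y, x ≠ y → I.TrivialOn x y
  · exact Instance.satisfiable_of_trivialOn hI.nonempty htriv
  push Not at htriv
  obtain ⟨x, y, hxy, hn⟩ := htriv
  rcases hI.satisfiable_or_prefers_nonempty ih with hsat | hpref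
  · exact hsat
  obtain ⟨v, hv⟩ := hI.nonempty x
  obtain ⟨E, hE, hEx⟩ := hI.sac.exists_family hv
  have h₀ : IsPathTrace I E x {x} (fun _ => v) x := by
    refine ⟨rfl, ?_, ?_, ?_, rfl, fun h => (h rfl).elim⟩
    · rintro _ rfl; simp [hEx]
    · rintro _ rfl _ rfl h; exact (h rfl).elim
    · rintro _ rfl h; exact (h rfl).elim
  obtain ⟨S, -, ⟨s, t, hS⟩, hmax⟩ :=
    (toFinite {S : Set X | ∃ s t, IsPathTrace I E x S s t}).exists_le_maximal (a := {x})
      ⟨_, _, h₀⟩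
  refine hI.satisfiable_of_autark isMonotone_Q2 ih (S := S) (s := s)
    (fun z hz => hE.subset z (hS.mem z hz)) hS.rel (fun z hz w hw => ?_) hS.root_mem hxy hn
  by_contra hfull
  obtain ⟨w', hw', s', h'⟩ := hS.exists_insert hI hpref hE hEx ⟨z, hz, w, hw, hfull⟩
  exact hw' (hmax ⟨s', w', h'⟩ (subset_insert _ _) (mem_insert _ _))

end Pattern

end BinaryCSP

/-! ### Families of preferences without cycles -/

namespace BinaryCSP

open Set

/-- A case of Hall's theorem: three nonempty sets have distinct representatives unless two of them
are the same singleton or their union has at most two elements. -/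
theorem exists_of_no_distinct_representatives {X : Type u} {A B C : Set X} (hA : A.Nonempty)
    (hB : B.Nonempty) (hC : C.Nonempty) (h : ∀ p ∈ A, ∀ q ∈ B, ∀ r ∈ C, p = q ∨ q = r ∨ p = r) :
    (∃ P, (A ⊆ {P} ∧ B ⊆ {P}) ∨ (B ⊆ {P} ∧ C ⊆ {P}) ∨ (A ⊆ {P} ∧ C ⊆ {P})) ∨
      ∃ P R, A ⊆ {P, R} ∧ B ⊆ {P, R} ∧ C ⊆ {P, R} := by
  have single : ∀ {A B C : Set X} {P : X}, A.Nonempty → A ⊆ {P} →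
      (∀ p ∈ A, ∀ q ∈ B, ∀ r ∈ C, p = q ∨ q = r ∨ p = r) →
      B ⊆ {P} ∨ C ⊆ {P} ∨ ∃ R, A ⊆ {P, R} ∧ B ⊆ {P, R} ∧ C ⊆ {P, R} := by
    rintro A B C P ⟨a, ha⟩ hAP h
    obtain rfl : a = P := hAP ha
    by_contra! hcon
    obtain ⟨hB, hC, hR⟩ := hcon
    obtain ⟨q, hq, hqa⟩ := not_subset.1 hB
    obtain ⟨r, hr, hra⟩ := not_subset.1 hC
    simp only [mem_singleton_iff] at hqa hra
    have hqr : q = r := by grind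
    refine hR q (hAP.trans (by simp)) (fun b hb => ?_) fun c hc => ?_
    · have := h a ha b hb r hr
      simp only [mem_insert_iff, mem_singleton_iff]
      grind
    · have := h a ha q hq c hc
      simp only [mem_insert_iff, mem_singleton_iff]
      grind
  by_cases hA' : ∃ P, A ⊆ {P}
  · obtain ⟨P, hP⟩ := hA'
    rcases single hA hP h with h' | h' | ⟨R, h'⟩
    · exact Or.inl ⟨P, Or.inl ⟨hP, h'⟩⟩
    · exact Or.inl ⟨P, Or.inr (Or.inr ⟨hP, h'⟩)⟩
    · exact Or.inr ⟨P, R, h'⟩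
  by_cases hB' : ∃ P, B ⊆ {P}
  · obtain ⟨P, hP⟩ := hB'
    have h₁ : ∀ p ∈ B, ∀ q ∈ C, ∀ r ∈ A, p = q ∨ q = r ∨ p = r := by grind
    rcases single hB hP h₁ with h' | h' | ⟨R, h'⟩
    · exact Or.inl ⟨P, Or.inr (Or.inl ⟨hP, h'⟩)⟩
    · exact Or.inl ⟨P, Or.inl ⟨h', hP⟩⟩
    · exact Or.inr ⟨P, R, h'.2.2, h'.1, h'.2.1⟩
  by_cases hC' : ∃ P, C ⊆ {P}
  · obtain ⟨P, hP⟩ := hC'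
    have h₁ : ∀ p ∈ C, ∀ q ∈ A, ∀ r ∈ B, p = q ∨ q = r ∨ p = r := by grind
    rcases single hC hP h₁ with h' | h' | ⟨R, h'⟩
    · exact Or.inl ⟨P, Or.inr (Or.inr ⟨h', hP⟩)⟩
    · exact Or.inl ⟨P, Or.inr (Or.inl ⟨h', hP⟩)⟩
    · exact Or.inr ⟨P, R, h'.2.1, h'.2.2, h'.1⟩
  have two : ∀ {T : Set X}, (¬ ∃ P, T ⊆ {P}) → ∀ P, ∃ q ∈ T, q ≠ P := fun hT P => by
    by_contra! hcon
    exact hT ⟨P, hcon⟩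
  obtain ⟨a, ha⟩ := hA
  obtain ⟨q, hq, hqa⟩ := two hB' a
  have hCsub : ∀ c ∈ C, c = a ∨ c = q := fun c hc => by grind
  have haC : a ∈ C := by
    obtain ⟨c, hc, hcq⟩ := two hC' q
    exact (hCsub c hc).resolve_right hcq ▸ hc
  have hqC : q ∈ C := by
    obtain ⟨c, hc, hca⟩ := two hC' a
    exact (hCsub c hc).resolve_left hca ▸ hc
  refine Or.inr ⟨a, q, fun p hp => ?_, fun b hb => ?_, hCsub⟩
  · rcases h p hp q hq a haC with h' | h' | h'
    · exact Or.inr h'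
    · exact (hqa h').elim
    · exact Or.inl h'
  · rcases h a ha b hb q hqC with h' | h' | h'
    · exact Or.inl h'.symm
    · exact Or.inr h'
    · exact (hqa h'.symm).elim

/-- Let `d a b` be the set of the variables preferring `a` to `b`. If no three values are preferred
to each other cyclically by three distinct variables, then at most two variables distinguish any
values at all, or the values fall into two classes inside of which only one variable `P`
distinguishes. -/
theorem exists_two_or_two_classes {X : Type u} {D : Type v} {A : Set D} {d : D → D → Set X}
    (hself : ∀ a, d a a = ∅) (htri : ∀ a b c, d a b ⊆ d a c ∪ d c b)
    (hne : ∀ a ∈ A, ∀ b ∈ A, a ≠ b → (d a b).Nonempty)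
    (hcyc : ∀ a ∈ A, ∀ b ∈ A, ∀ c ∈ A, ∀ p ∈ d a b, ∀ q ∈ d b c, ∀ r ∈ d c a,
      p = q ∨ q = r ∨ p = r) (hA : A.Nonempty) (hX : Nonempty X) :
    (∃ P R, ∀ a ∈ A, ∀ b ∈ A, d a b ⊆ {P, R}) ∨
      ∃ P, ∃ H : Set D, ∀ a ∈ A, ∀ b ∈ A, (a ∈ H ↔ b ∈ H) → d a b ⊆ {P} := by
  classical
  set e : D → D → Set X := fun a b => d a b ∪ d b a with he
  have hes : ∀ a b, e a b = e b a := fun a b => union_comm _ _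
  have het : ∀ a b c, e a b ⊆ e a c ∪ e c b := by
    rintro a b c x (hx | hx)
    · rcases htri a b c hx with h | h
      · exact Or.inl (Or.inl h)
      · exact Or.inr (Or.inl h)
    · rcases htri b a c hx with h | h
      · exact Or.inr (Or.inr h)
      · exact Or.inl (Or.inr h)
  have hde : ∀ a b, d a b ⊆ e a b := fun a b => subset_union_left
  have het' : ∀ {a b c : D} {T : Set X}, e a c ⊆ T → e c b ⊆ T → e a b ⊆ T := fun h1 h2 =>
    (het _ _ _).trans (union_subset h1 h2)
  by_cases hb : ∀ a ∈ A, ∀ b ∈ A, ∀ c ∈ A, a ≠ b → b ≠ c → a ≠ c →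
      ∃ P R, e a b ⊆ {P, R} ∧ e a c ⊆ {P, R} ∧ e b c ⊆ {P, R}
  · by_cases hsmall : ∀ a ∈ A, ∀ b ∈ A, ∀ c ∈ A, a = b ∨ b = c ∨ a = c
    · right
      obtain ⟨a, ha⟩ := hA
      obtain ⟨P⟩ := hX
      refine ⟨P, {a}, fun b hb c hc hbc => ?_⟩
      have : b = c := by
        rcases hsmall a ha b hb c hc with h | h | h
        · exact h ▸ (hbc.1 h.symm).symm
        · exact h
        · exact h ▸ hbc.2 h.symm
      rw [this, hself]
      exact empty_subset _
    left
    push Not at hsmall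
    obtain ⟨a₀, ha₀, b₀, hb₀, c₀, hc₀, hab₀, hbc₀, hac₀⟩ := hsmall
    by_cases htwo : ∃ a ∈ A, ∃ b ∈ A, ∃ P ∈ e a b, ∃ R ∈ e a b, P ≠ R
    · obtain ⟨a, ha, b, hb', P, hP, R, hR, hPR⟩ := htwo
      have hab : a ≠ b := by rintro rfl; simp [e, hself] at hP
      have key : ∀ c ∈ A, c ≠ a → c ≠ b → e a b ⊆ {P, R} ∧ e a c ⊆ {P, R} := by
        intro c hc hca hcb
        obtain ⟨P', R', h1, h2, -⟩ := hb a ha b hb' c hc hab (Ne.symm hcb) (Ne.symm hca)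
        have h : ({P', R'} : Set X) ⊆ {P, R} := by
          have hP' := h1 hP
          have hR' := h1 hR
          simp only [mem_insert_iff, mem_singleton_iff, subset_def] at *
          grind
        exact ⟨h1.trans h, h2.trans h⟩
      obtain ⟨c, hc, hca, hcb⟩ : ∃ c ∈ A, c ≠ a ∧ c ≠ b := by grind
      have hall : ∀ c ∈ A, e a c ⊆ {P, R} := by
        intro c' hc'
        by_cases h1 : c' = a
        · simp [h1, e, hself]
        by_cases h2 : c' = b
        · exact h2 ▸ (key c hc hca hcb).1
        · exact (key c' hc' h1 h2).2
      exact ⟨P, R, fun x hx y hy => (hde x y).trans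
        (het' (hes x a ▸ hall x hx) (hall y hy))⟩
    · push Not at htwo
      obtain ⟨P, hP⟩ := hne a₀ ha₀ b₀ hb₀ hab₀
      have hP' : P ∈ e a₀ b₀ := hde _ _ hP
      have hall : ∀ c ∈ A, e a₀ c ⊆ {P} := by
        intro c hc R hR
        by_contra hRP
        have h1 : P ∉ e a₀ c := fun h => hRP (htwo a₀ ha₀ c hc R hR P h)
        have h2 : R ∉ e a₀ b₀ := fun h => hRP (htwo a₀ ha₀ b₀ hb₀ R h P hP')
        have h3 : P ∈ e c b₀ := (het _ _ c hP').resolve_left h1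
        have h4 : R ∈ e b₀ c := (het _ _ b₀ hR).resolve_left h2
        exact hRP (htwo c hc b₀ hb₀ R (hes b₀ c ▸ h4) P h3)
      refine ⟨P, P, fun x hx y hy => (hde x y).trans ?_⟩
      rw [pair_eq_singleton]
      exact het' (hes x a₀ ▸ hall x hx) (hall y hy)
  -- a triple on which three variables distinguish has two values distinguished by one variable
  -- only, which is also the only one with a certain preference regarding the third value
  have triple : ∀ a ∈ A, ∀ b ∈ A, ∀ c ∈ A, a ≠ b → b ≠ c → a ≠ c →
      (¬ ∃ P R, e a b ⊆ {P, R} ∧ e a c ⊆ {P, R} ∧ e b c ⊆ {P, R}) →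
      ∃ P, (e a b ⊆ {P} ∧ (d a c ⊆ {P} ∨ d c a ⊆ {P})) ∨
        (e a c ⊆ {P} ∧ (d a b ⊆ {P} ∨ d b a ⊆ {P})) ∨
        (e b c ⊆ {P} ∧ (d a b ⊆ {P} ∨ d b a ⊆ {P})) := by
    intro a ha b hb' c hc hab hbc hac hnot
    have hT : ∀ P R, d a b ⊆ {P, R} → d b c ⊆ {P, R} → d c a ⊆ {P, R} → False := by
      intro P R h1 h2 h3
      have h4 : d b a ⊆ {P, R} := (htri b a c).trans (union_subset h2 h3)
      have h5 : d c b ⊆ {P, R} := (htri c b a).trans (union_subset h3 h1)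
      have h6 : d a c ⊆ {P, R} := (htri a c b).trans (union_subset h1 h2)
      exact hnot ⟨P, R, union_subset h1 h4, union_subset h6 h3, union_subset h2 h5⟩
    have hT' : ∀ P R, d a c ⊆ {P, R} → d c b ⊆ {P, R} → d b a ⊆ {P, R} → False := by
      intro P R h1 h2 h3
      have h4 : d c a ⊆ {P, R} := (htri c a b).trans (union_subset h2 h3)
      have h5 : d b c ⊆ {P, R} := (htri b c a).trans (union_subset h3 h1)
      have h6 : d a b ⊆ {P, R} := (htri a b c).trans (union_subset h1 h2)
      exact hnot ⟨P, R, union_subset h6 h3, union_subset h1 h4, union_subset h5 h2⟩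
    obtain ⟨P, hP⟩ := (exists_of_no_distinct_representatives (hne a ha b hb' hab)
      (hne b hb' c hc hbc) (hne c hc a ha hac.symm)
      (hcyc a ha b hb' c hc)).resolve_right fun ⟨P, R, h1, h2, h3⟩ => hT P R h1 h2 h3
    obtain ⟨R, hR⟩ := (exists_of_no_distinct_representatives (hne a ha c hc hac)
      (hne c hc b hb' hbc.symm) (hne b hb' a ha hab.symm)
      (hcyc a ha c hc b hb')).resolve_right fun ⟨P, R, h1, h2, h3⟩ => hT' P R h1 h2 h3
    have hsub : ∀ {P R : X} {T : Set X}, T ⊆ {P} → T ⊆ {P, R} := fun h => h.trans (by simp)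
    have hsub' : ∀ {P R : X} {T : Set X}, T ⊆ {R} → T ⊆ {P, R} := fun h => h.trans (by simp)
    have htri' : ∀ {x y z : D} {T : Set X}, d x z ⊆ T → d z y ⊆ T → d x y ⊆ T := fun h1 h2 =>
      (htri _ _ _).trans (union_subset h1 h2)
    have huniq : ∀ {x y : D} {P R : X}, x ∈ A → y ∈ A → x ≠ y → d x y ⊆ {P} → d x y ⊆ {R} →
        P = R := by
      intro x y P R hx hy hxy h1 h2
      obtain ⟨t, ht⟩ := hne x hx y hy hxy
      exact (h1 ht).symm.trans (h2 ht)
    refine ⟨P, ?_⟩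
    rcases hP with ⟨h1, h2⟩ | ⟨h1, h2⟩ | ⟨h1, h2⟩
    · have h3 : d a c ⊆ {P} := htri' h1 h2
      rcases hR with ⟨g1, g2⟩ | ⟨g1, g2⟩ | ⟨g1, g2⟩
      · obtain rfl := huniq ha hc hac h3 g1
        exact Or.inr (Or.inr ⟨union_subset h2 g2, Or.inl h1⟩)
      · exact (hT P R (hsub h1) (hsub h2) (hsub' (htri' g1 g2))).elim
      · obtain rfl := huniq ha hc hac h3 g1
        exact Or.inl ⟨union_subset h1 g2, Or.inl h3⟩
    · have h3 : d b a ⊆ {P} := htri' h1 h2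
      rcases hR with ⟨g1, g2⟩ | ⟨g1, g2⟩ | ⟨g1, g2⟩
      · exact (hT P R (hsub' (htri' g1 g2)) (hsub h1) (hsub h2)).elim
      · obtain rfl := huniq hb' ha hab.symm h3 g2
        exact Or.inr (Or.inr ⟨union_subset h1 g1, Or.inr h3⟩)
      · obtain rfl := huniq hb' ha hab.symm h3 g2
        exact Or.inr (Or.inl ⟨union_subset g1 h2, Or.inr h3⟩)
    · have h3 : d c b ⊆ {P} := htri' h2 h1
      rcases hR with ⟨g1, g2⟩ | ⟨g1, g2⟩ | ⟨g1, g2⟩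
      · obtain rfl := huniq hc hb' hbc.symm h3 g2
        exact Or.inr (Or.inl ⟨union_subset g1 h2, Or.inl h1⟩)
      · obtain rfl := huniq hc hb' hbc.symm h3 g1
        exact Or.inl ⟨union_subset h1 g2, Or.inr h2⟩
      · exact (hT P R (hsub h1) (hsub' (htri' g2 g1)) (hsub h2)).elim
  right
  push Not at hb
  obtain ⟨x, y, z, hx, hy, hz, hxy, hyz, hxz, P, hxyP, hdir, hbig⟩ : ∃ x y z, x ∈ A ∧ y ∈ A ∧ z ∈ A ∧
      x ≠ y ∧ y ≠ z ∧ x ≠ z ∧ ∃ P, e x y ⊆ {P} ∧ (d x z ⊆ {P} ∨ d z x ⊆ {P}) ∧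
      ∀ Q R, ¬ (e x y ⊆ {Q, R} ∧ e x z ⊆ {Q, R}) := by
    obtain ⟨a, ha, b, hb', c, hc, hab, hbc, hac, hno⟩ := hb
    have hno' : ¬ ∃ P R, e a b ⊆ {P, R} ∧ e a c ⊆ {P, R} ∧ e b c ⊆ {P, R} :=
      fun ⟨P, R, h1, h2, h3⟩ => hno P R h1 h2 h3
    obtain ⟨P, ⟨h1, h2⟩ | ⟨h1, h2⟩ | ⟨h1, h2⟩⟩ := triple a ha b hb' c hc hab hbc hac hno'
    · exact ⟨a, b, c, ha, hb', hc, hab, hbc, hac, P, h1, h2, fun Q R ⟨g1, g2⟩ =>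
        hno Q R g1 g2 (het' (hes a b ▸ g1) g2)⟩
    · exact ⟨a, c, b, ha, hc, hb', hac, hbc.symm, hab, P, h1, h2, fun Q R ⟨g1, g2⟩ =>
        hno Q R g2 g1 (het' (hes a b ▸ g2) g1)⟩
    · exact ⟨b, c, a, hb', hc, ha, hbc, hac.symm, hab.symm, P, h1, h2.symm, fun Q R ⟨g1, g2⟩ =>
        hno Q R (hes b a ▸ g2) (het' (hes b a ▸ g2) g1) g1⟩
  have hP1 : ∀ {R : X} {T : Set X}, T ⊆ {P} → T ⊆ {P, R} := fun h => h.trans (by simp)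
  -- `x` and `z` are distinguished by at least three variables
  have hxz3 : ∀ Q R, ¬ e x z ⊆ {Q, R} := by
    intro Q R h
    refine hbig Q R ⟨hxyP.trans (singleton_subset_iff.2 ?_), h⟩
    rcases hdir with h' | h'
    · obtain ⟨t, ht⟩ := hne x hx z hz hxz
      exact (h' ht : t = P) ▸ h (Or.inl ht)
    · obtain ⟨t, ht⟩ := hne z hz x hx hxz.symm
      exact (h' ht : t = P) ▸ h (Or.inr ht)
  have heq : ∀ R, (d x z ⊆ {R} ∨ d z x ⊆ {R}) → R = P := by
    rintro R (h | h) <;> rcases hdir with h' | h'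
    · obtain ⟨t, ht⟩ := hne x hx z hz hxz
      exact (h ht).symm.trans (h' ht)
    · exact (hxz3 P R (union_subset (h.trans (by simp)) (hP1 h'))).elim
    · exact (hxz3 P R (union_subset (hP1 h') (h.trans (by simp)))).elim
    · obtain ⟨t, ht⟩ := hne z hz x hx hxz.symm
      exact (h ht).symm.trans (h' ht)
  -- the classes of `x` and `z`
  have hclass : ∀ u ∈ A, e x u ⊆ {P} ∨ e z u ⊆ {P} := by
    intro u hu
    by_cases hux : u = x
    · exact Or.inl (by simp [hux, e, hself])
    by_cases huz : u = z
    · exact Or.inr (by simp [huz, e, hself])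
    obtain ⟨R, h | h | h⟩ := triple x hx z hz u hu hxz (Ne.symm huz) (Ne.symm hux)
      fun ⟨Q, R, h, _⟩ => hxz3 Q R h
    · exact (hxz3 R R (h.1.trans (by simp))).elim
    · exact Or.inl (heq R h.2 ▸ h.1)
    · exact Or.inr (heq R h.2 ▸ h.1)
  refine ⟨P, {u | e x u ⊆ {P}}, fun a ha b hb' hab => (hde a b).trans ?_⟩
  rcases hclass a ha with h | h
  · exact het' (hes x a ▸ h) (hab.1 h)
  · have hbz : e z b ⊆ {P} := by
      refine (hclass b hb').resolve_left fun hbx => hxz3 P P (hP1 ?_)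
      exact het' (hab.2 hbx) (hes z a ▸ h)
    exact het' (hes z a ▸ h) hbz

end BinaryCSP

/-! ### Nets of constraints and 2-satisfiability -/

namespace BinaryCSP

open Set

/-- A set of constraints in which a pair of variables may carry several constraints, and which may
contain loops. -/
abbrev Net (X : Type u) (D : Type v) := Set (X × X × (D → D → Prop))

namespace Net

variable {X : Type u} {D : Type v} {K : Net X D} {dom : X → Set D}

/-- Nonempty subdomains on which every constraint of the net is arc consistent. -/
structure IsACFamily (K : Net X D) (dom E : X → Set D) : Prop where
  subset : ∀ x, E x ⊆ dom x
  nonempty : ∀ x, (E x).Nonempty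
  fst : ∀ e ∈ K, ∀ a ∈ E e.1, ∃ b ∈ E e.2.1, e.2.2 a b
  snd : ∀ e ∈ K, ∀ b ∈ E e.2.1, ∃ a ∈ E e.1, e.2.2 a b

/-- Singleton arc consistency of a net with the domains `dom`. -/
def IsSAC (K : Net X D) (dom : X → Set D) : Prop :=
  ∀ x, ∀ a ∈ dom x, ∃ E, IsACFamily K dom E ∧ E x = {a}

/-- A solution of a net: values in the domains that satisfy all its constraints. -/
def IsSolution (K : Net X D) (dom : X → Set D) (s : X → D) : Prop :=
  (∀ x, s x ∈ dom x) ∧ ∀ e ∈ K, e.2.2 (s e.1) (s e.2.1)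

/-- The constraint `e`, read in one of its two directions, is the relation `σ` from `x` to `y`. -/
def Joins (e : X × X × (D → D → Prop)) (x y : X) (σ : D → D → Prop) : Prop :=
  e = (x, y, σ) ∨ e = (y, x, fun b a => σ a b)

theorem Joins.symm {e : X × X × (D → D → Prop)} {x y : X} {σ : D → D → Prop} (h : Joins e x y σ) :
    Joins e y x fun b a => σ a b := h.elim Or.inr Or.inl

/-- `x` is one of the two variables of the constraint `e`. -/
def Incident (e : X × X × (D → D → Prop)) (x : X) : Prop := e.1 = x ∨ e.2.1 = x

theorem Incident.exists_joins {e : X × X × (D → D → Prop)} {x : X} (h : Incident e x) :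
    ∃ y σ, Joins e x y σ := by
  obtain ⟨a, b, ρ⟩ := e
  rcases h with h | h
  · obtain rfl : a = x := h
    exact ⟨b, ρ, Or.inl rfl⟩
  · obtain rfl : b = x := h
    exact ⟨a, fun c d => ρ d c, Or.inr rfl⟩

theorem Joins.incident_iff {e : X × X × (D → D → Prop)} {x y z : X} {σ : D → D → Prop}
    (h : Joins e x y σ) : Incident e z ↔ z = x ∨ z = y := by
  rcases h with rfl | rfl
  · simp only [Incident, eq_comm]
  · simp only [Incident, eq_comm, or_comm]

theorem IsACFamily.support {E : X → Set D} (hE : IsACFamily K dom E) {e : X × X × (D → D → Prop)}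
    (he : e ∈ K) {x y : X} {σ : D → D → Prop} (h : Joins e x y σ) {a : D} (ha : a ∈ E x) :
    ∃ b ∈ E y, σ a b := by
  rcases h with rfl | rfl
  · exact hE.fst _ he a ha
  · exact hE.snd _ he a ha

theorem IsSolution.rel {s : X → D} (hs : IsSolution K dom s) {e : X × X × (D → D → Prop)}
    (he : e ∈ K) {x y : X} {σ : D → D → Prop} (h : Joins e x y σ) : σ (s x) (s y) := by
  rcases h with rfl | rfl
  · exact hs.2 _ he
  · exact hs.2 _ he

theorem IsACFamily.mono {E : X → Set D} (hE : IsACFamily K dom E) {K' : Net X D} (h : K' ⊆ K) :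
    IsACFamily K' dom E :=
  ⟨hE.subset, hE.nonempty, fun e he => hE.fst e (h he), fun e he => hE.snd e (h he)⟩

theorem IsSAC.mono (hK : IsSAC K dom) {K' : Net X D} (h : K' ⊆ K) : IsSAC K' dom := fun x a ha =>
  let ⟨E, hE, hx⟩ := hK x a ha
  ⟨E, hE.mono h, hx⟩

/-- At most two constraints are incident with `x`. -/
def DegreeLeTwo (K : Net X D) (x : X) : Prop :=
  ∃ e₁ e₂, ∀ e ∈ K, Incident e x → e = e₁ ∨ e = e₂

theorem DegreeLeTwo.mono {x : X} (hK : DegreeLeTwo K x) {K' : Net X D} (h : K' ⊆ K) :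
    DegreeLeTwo K' x :=
  let ⟨e₁, e₂, he⟩ := hK
  ⟨e₁, e₂, fun e he' => he e (h he')⟩

/-- If all constraints are at variables with at most two values, then the variables to which the
assignment of some variable leaves a single value can be given these values. -/
theorem exists_isSolution_of_small (hK : IsSAC K dom) (hne : ∀ x, (dom x).Nonempty)
    (hsmall : ∀ e ∈ K, ∀ x, Incident e x → ∃ a b, dom x ⊆ {a, b})
    (ih : ∀ K' ⊂ K, ∃ s, IsSolution K' dom s) : ∃ s, IsSolution K dom s := by
  classical
  rcases K.eq_empty_or_nonempty with rfl | ⟨e₀, he₀⟩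
  · choose s hs using hne
    exact ⟨s, hs, fun e he => he.elim⟩
  obtain ⟨v, hv⟩ := hne e₀.1
  obtain ⟨E, hE, hEx⟩ := hK _ v hv
  -- a variable outside `S` keeps its whole domain in `E`, so the constraints between it and the
  -- variables of `S` are satisfied by any of its values
  set S : Set X := {w | E w ≠ dom w ∨ w = e₀.1}
  have hsingle : ∀ e ∈ K, ∀ w ∈ S, Incident e w → ∀ a ∈ E w, ∀ b ∈ E w, a = b := by
    intro e he w hw hew a ha b hb
    rcases hw with hw | rfl
    · by_contra hab
      obtain ⟨c, d, hcd⟩ := hsmall e he w hew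
      refine hw ((hE.subset w).antisymm fun f hf => ?_)
      have h1 := hcd (hE.subset w ha)
      have h2 := hcd (hE.subset w hb)
      have h3 := hcd hf
      simp only [mem_insert_iff, mem_singleton_iff] at h1 h2 h3
      have : f = a ∨ f = b := by grind
      exact this.elim (fun h => h ▸ ha) fun h => h ▸ hb
    · rw [hEx] at ha hb
      exact Eq.trans ha (Eq.symm hb)
  obtain ⟨t, ht⟩ := ih {e ∈ K | e.1 ∉ S ∧ e.2.1 ∉ S} <|
    (ssubset_iff_of_subset fun e he => he.1).2 ⟨e₀, he₀, fun h => h.2.1 (Or.inr rfl)⟩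
  choose r hr using hE.nonempty
  have hsE : ∀ w, (if w ∈ S then r w else t w) ∈ E w := by
    intro w
    by_cases hw : w ∈ S
    · simpa [hw] using hr w
    · have : E w = dom w := by
        by_contra h
        exact hw (Or.inl h)
      simpa only [hw, if_false, this] using ht.1 w
  refine ⟨fun w => if w ∈ S then r w else t w, fun w => hE.subset w (hsE w), fun e he => ?_⟩
  dsimp only
  by_cases h1 : e.1 ∈ S
  · obtain ⟨a, ha, hab⟩ := hE.snd e he _ (hsE e.2.1)
    rwa [hsingle e he e.1 h1 (Or.inl rfl) _ (hsE e.1) a ha]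
  by_cases h2 : e.2.1 ∈ S
  · obtain ⟨b, hb, hab⟩ := hE.fst e he _ (hsE e.1)
    rwa [hsingle e he e.2.1 h2 (Or.inr rfl) _ (hsE e.2.1) b hb]
  simpa only [h1, h2, if_false] using ht.2 e ⟨he, h1, h2⟩

/-- A singleton arc consistent net in which every variable has at most two values or is in at most
two constraints has a solution: a variable in two constraints can be eliminated by composing them,
and the net left is an instance of 2-satisfiability. -/
theorem exists_isSolution [Finite X] [Finite D] (hK : IsSAC K dom) (hne : ∀ x, (dom x).Nonempty)
    (hdeg : ∀ x, (∃ a b, dom x ⊆ {a, b}) ∨ DegreeLeTwo K x) : ∃ s, IsSolution K dom s := by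
  classical
  induction hn : K.ncard using Nat.strong_induction_on generalizing K with
  | _ n ih =>
  subst hn
  have ihsub : ∀ K' ⊂ K, ∃ s, IsSolution K' dom s := fun K' hK' =>
    ih _ (ncard_lt_ncard hK' (toFinite _)) (hK.mono hK'.subset)
      (fun x => (hdeg x).imp_right fun h => h.mono hK'.subset) rfl
  -- singleton arc consistency makes loops hold for all values
  by_cases hloop : ∃ e ∈ K, e.1 = e.2.1
  · obtain ⟨e, he, hee⟩ := hloop
    obtain ⟨s, hs⟩ := ihsub (K \ {e})
      ((ssubset_iff_of_subset sdiff_subset).2 ⟨e, he, fun h => h.2 rfl⟩)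
    refine ⟨s, hs.1, fun f hf => ?_⟩
    by_cases hfe : f = e
    · subst hfe
      obtain ⟨E, hE, hx⟩ := hK _ _ (hs.1 f.1)
      obtain ⟨b, hb, hab⟩ := hE.fst f hf (s f.1) (by simp [hx])
      rw [← hee, hx] at hb
      rw [← hee]
      exact (show b = s f.1 from hb) ▸ hab
    · exact hs.2 f ⟨hf, hfe⟩
  push Not at hloop
  have hloop' : ∀ e ∈ K, ∀ {x y σ}, Joins e x y σ → x ≠ y := by
    rintro e he x y σ (rfl | rfl)
    · exact hloop _ he
    · exact (hloop _ he).symm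
  by_cases hbig : ∀ e ∈ K, ∀ x, Incident e x → ∃ a b, dom x ⊆ {a, b}
  · exact exists_isSolution_of_small hK hne hbig ihsub
  push Not at hbig
  obtain ⟨e₁, he₁, x, hx, hxbig⟩ := hbig
  have hxdeg : ∃ e₂, ∀ e ∈ K, Incident e x → e = e₁ ∨ e = e₂ := by
    obtain ⟨f, g, hfg⟩ := (hdeg x).resolve_left fun ⟨a, b, h⟩ => hxbig a b h
    rcases hfg e₁ he₁ hx with rfl | rfl
    · exact ⟨g, hfg⟩
    · exact ⟨f, fun e he h => (hfg e he h).symm⟩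
  obtain ⟨P, σ₁, hj₁⟩ := hx.exists_joins
  have hxP : x ≠ P := hloop' e₁ he₁ hj₁
  -- a solution of a net whose constraints not incident with `x` include those of `K` extends
  have extend : ∀ {K' : Net X D} {s : X → D}, IsSolution K' dom s →
      (∀ e ∈ K, ¬ Incident e x → e ∈ K') → ∀ a ∈ dom x,
      (∀ e ∈ K, Incident e x → ∃ y σ, Joins e x y σ ∧ σ a (s y)) → ∃ s, IsSolution K dom s := by
    intro K' s hs hK' a ha h
    refine ⟨Function.update s x a, fun y => ?_, fun e he => ?_⟩
    · by_cases hy : y = x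
      · subst hy; simpa using ha
      · simpa [hy] using hs.1 y
    · by_cases hex : Incident e x
      · obtain ⟨y, σ, hj, hσ⟩ := h e he hex
        have hyx := (hloop' e he hj).symm
        rcases hj with rfl | rfl <;> simpa [hyx] using hσ
      · have h1 : e.1 ≠ x := fun h => hex (Or.inl h)
        have h2 : e.2.1 ≠ x := fun h => hex (Or.inr h)
        simpa [h1, h2] using hs.2 e (hK' e he hex)
  obtain ⟨e₂, hxdeg⟩ := hxdeg
  by_cases htwo : e₂ ∈ K ∧ Incident e₂ x ∧ e₂ ≠ e₁
  · obtain ⟨he₂, hx₂, hne₂⟩ := htwo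
    obtain ⟨R, σ₂, hj₂⟩ := hx₂.exists_joins
    have hxR : x ≠ R := hloop' e₂ he₂ hj₂
    -- the composition of the two constraints
    set f : X × X × (D → D → Prop) := (P, R, fun p r => ∃ a ∈ dom x, σ₁ a p ∧ σ₂ a r) with hf
    set K' : Net X D := insert f (K \ {e₁, e₂}) with hK'
    have hcard : K'.ncard < K.ncard := by
      have h1 : (K \ {e₁, e₂}).ncard + ({e₁, e₂} : Net X D).ncard = K.ncard :=
        ncard_sdiff_add_ncard_of_subset (by simp [pair_subset_iff, he₁, he₂]) (toFinite _)
      rw [ncard_pair hne₂.symm] at h1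
      have : K'.ncard ≤ (K \ {e₁, e₂}).ncard + 1 := ncard_insert_le f _
      omega
    have hsac : IsSAC K' dom := by
      intro y b hb
      obtain ⟨E, hE, hy⟩ := hK y b hb
      refine ⟨E, ⟨hE.subset, hE.nonempty, ?_, ?_⟩, hy⟩
      · rintro e (rfl | he) c hc
        · obtain ⟨a, ha, hac⟩ := hE.support he₁ hj₁.symm hc
          obtain ⟨r, hr, har⟩ := hE.support he₂ hj₂ ha
          exact ⟨r, hr, a, hE.subset x ha, hac, har⟩
        · exact hE.fst e he.1 c hc
      · rintro e (rfl | he) c hc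
        · obtain ⟨a, ha, hac⟩ := hE.support he₂ hj₂.symm hc
          obtain ⟨p, hp, hap⟩ := hE.support he₁ hj₁ ha
          exact ⟨p, hp, a, hE.subset x ha, hap, hac⟩
        · exact hE.snd e he.1 c hc
    have hdeg' : ∀ y, (∃ a b, dom y ⊆ {a, b}) ∨ DegreeLeTwo K' y := by
      intro y
      refine (hdeg y).imp_right ?_
      rintro ⟨g, h, hgh⟩
      have hfy : Incident f y ↔ P = y ∨ R = y := Iff.rfl
      have h1 : Incident e₁ y ↔ y = x ∨ y = P := hj₁.incident_iff
      have h2 : Incident e₂ y ↔ y = x ∨ y = R := hj₂.incident_iff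
      -- at `P` and `R`, the new constraint takes the place of `e₁` and `e₂`
      refine ⟨if g = e₁ ∨ g = e₂ then f else g, if h = e₁ ∨ h = e₂ then f else h, ?_⟩
      rintro e (rfl | he) hey
      · rcases hfy.1 hey with rfl | rfl
        · rcases hgh e₁ he₁ (h1.2 (Or.inr rfl)) with rfl | rfl <;> simp
        · rcases hgh e₂ he₂ (h2.2 (Or.inr rfl)) with rfl | rfl <;> simp
      · have hne : ¬ (e = e₁ ∨ e = e₂) := he.2
        rcases hgh e he.1 hey with rfl | rfl
        · exact Or.inl (if_neg hne).symm
        · exact Or.inr (if_neg hne).symm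
    obtain ⟨s, hs⟩ := ih _ hcard hsac hdeg' rfl
    obtain ⟨a, ha, h1, h2⟩ := hs.2 f (mem_insert _ _)
    refine extend hs (fun e he hex => Or.inr ⟨he, ?_⟩) a ha fun e he hex => ?_
    · rintro (rfl | rfl)
      · exact hex hx
      · exact hex hx₂
    · rcases hxdeg e he hex with rfl | rfl
      · exact ⟨P, σ₁, hj₁, h1⟩
      · exact ⟨R, σ₂, hj₂, h2⟩
  · obtain ⟨s, hs⟩ := ihsub (K \ {e₁})
      ((ssubset_iff_of_subset sdiff_subset).2 ⟨e₁, he₁, fun h => h.2 rfl⟩)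
    obtain ⟨E, hE, hEP⟩ := hK _ _ (hs.1 P)
    obtain ⟨a, ha, hσ⟩ := hE.support he₁ hj₁.symm (show s P ∈ E P by simp [hEP])
    refine extend hs (fun e he hex => ⟨he, ?_⟩) a (hE.subset x ha) fun e he hex => ?_
    · rintro rfl
      exact hex hx
    · have : e = e₁ := by
        by_contra hne
        have := (hxdeg e he hex).resolve_left hne
        exact htwo ⟨this ▸ he, this ▸ hex, this ▸ hne⟩
      exact ⟨P, σ₁, this ▸ hj₁, hσ⟩

end Net

namespace Instance

variable {X : Type u} {D : Type v} {I : Instance X D}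

/-- Only the constraints with at most two other variables are nontrivial at `x`. -/
def HasTwoNeighbours (I : Instance X D) (x : X) : Prop :=
  ∃ P R, ∀ y, x ≠ y → y ≠ P → y ≠ R → I.TrivialOn x y

theorem trivialOn_comm {x y : X} (h : x ≠ y) : I.TrivialOn x y ↔ I.TrivialOn y x :=
  ⟨fun ht a ha b hb => (I.rel_comm h).1 (ht b hb a ha),
    fun ht a ha b hb => (I.rel_comm h).2 (ht b hb a ha)⟩

/-- An instance is a net without parallel constraints, so `Net.exists_isSolution` applies to it. -/
theorem satisfiable_of_small_or_hasTwoNeighbours [Finite X] [Finite D]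
    (hI : I.SingletonArcConsistent) (hne : ∀ x, (I.dom x).Nonempty)
    (h : ∀ x, (∃ a b, I.dom x ⊆ {a, b}) ∨ I.HasTwoNeighbours x) : I.Satisfiable := by
  classical
  -- a well-ordering selects one direction of every constraint
  let K : Net X D := {e | WellOrderingRel e.1 e.2.1 ∧ e.2.2 = I.rel e.1 e.2.1 ∧
    ¬ I.TrivialOn e.1 e.2.1}
  have hKne : ∀ e ∈ K, e.1 ≠ e.2.1 := by
    intro e he h
    have := he.1
    rw [h] at this
    exact irrefl _ this
  have hsac : K.IsSAC I.dom := by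
    intro x a ha
    obtain ⟨E, hE, hx⟩ := hI.exists_family ha
    refine ⟨E, ⟨hE.subset, hE.nonempty, fun e he a ha => ?_, fun e he b hb => ?_⟩, hx⟩
    · rw [he.2.1]
      exact hE.support _ _ (hKne e he) a ha
    · obtain ⟨a, ha, hab⟩ := hE.support _ _ (hKne e he).symm b hb
      rw [he.2.1]
      exact ⟨a, ha, (I.rel_comm (hKne e he)).2 hab⟩
  have hdeg : ∀ x, (∃ a b, I.dom x ⊆ {a, b}) ∨ K.DegreeLeTwo x := by
    intro x
    refine (h x).imp_right ?_
    rintro ⟨P, R, hPR⟩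
    let f : X → X × X × (D → D → Prop) := fun y =>
      if WellOrderingRel x y then (x, y, I.rel x y) else (y, x, I.rel y x)
    have key : ∀ e ∈ K, Net.Incident e x → ∃ y, x ≠ y ∧ ¬ I.TrivialOn x y ∧ e = f y := by
      rintro ⟨y, z, ρ⟩ he hex
      have hyz : y ≠ z := hKne _ he
      obtain ⟨hlt, hρ, hn⟩ := he
      obtain rfl : ρ = I.rel y z := hρ
      rcases hex with h | h
      · obtain rfl : y = x := h
        exact ⟨z, hyz, hn, (if_pos hlt).symm⟩
      · obtain rfl : z = x := h
        exact ⟨y, hyz.symm, fun ht => hn ((trivialOn_comm hyz).2 ht), (if_neg (asymm hlt)).symm⟩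
    refine ⟨f P, f R, fun e he hex => ?_⟩
    obtain ⟨y, hxy, hn, rfl⟩ := key e he hex
    by_cases hyP : y = P
    · exact Or.inl (hyP ▸ rfl)
    by_cases hyR : y = R
    · exact Or.inr (hyR ▸ rfl)
    exact (hn (hPR y hxy hyP hyR)).elim
  obtain ⟨s, hs, hs'⟩ := Net.exists_isSolution hsac hne hdeg
  have key : ∀ x y, WellOrderingRel x y → I.rel x y (s x) (s y) := by
    intro x y hxy
    by_cases ht : I.TrivialOn x y
    · exact ht _ (hs x) _ (hs y)
    · exact hs' (x, y, I.rel x y) ⟨hxy, rfl, ht⟩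
  refine ⟨s, hs, fun x y hxy => ?_⟩
  rcases trichotomous_of WellOrderingRel x y with h | h | h
  · exact key x y h
  · exact (hxy h).elim
  · exact (I.rel_comm hxy).2 (key y x h)

end Instance

end BinaryCSP

/-! ### Variables with two classes, and the pattern Q1 -/

namespace BinaryCSP

open Set

namespace Instance

variable {X : Type u} {D : Type v} {I : Instance X D}

/-- The values of `x` fall into two classes, given by a set `H`, such that only one variable `P`
distinguishes values of the same class. -/
def HasTwoClasses (I : Instance X D) (x : X) : Prop :=
  ∃ P, ∃ H : Set D, ∀ a ∈ I.dom x, ∀ b ∈ I.dom x, (a ∈ H ↔ b ∈ H) → ∀ y, x ≠ y → y ≠ P →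
    ∀ q ∈ I.dom y, I.rel x y a q → I.rel x y b q

/-- The quotient in which every value `a` of `x` is replaced by `f x a`, with the constraints
induced by those of the values replaced. -/
def mapValues (I : Instance X D) (f : X → D → D) : Instance X D where
  dom x := f x '' I.dom x
  rel x y a b := ∃ a' ∈ I.dom x, ∃ b' ∈ I.dom y, f x a' = a ∧ f y b' = b ∧ I.rel x y a' b'
  rel_symm x y a b h := by
    constructor
    · rintro ⟨a', ha, b', hb, h1, h2, hr⟩
      exact ⟨b', hb, a', ha, h2, h1, (I.rel_comm h).1 hr⟩
    · rintro ⟨b', hb, a', ha, h2, h1, hr⟩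
      exact ⟨a', ha, b', hb, h1, h2, (I.rel_comm h).2 hr⟩

theorem SingletonArcConsistent.mapValues (hI : I.SingletonArcConsistent) (f : X → D → D) :
    (I.mapValues f).SingletonArcConsistent := by
  refine .of_families ?_
  rintro x _ ⟨a, ha, rfl⟩
  obtain ⟨E, hE, hx⟩ := hI.exists_family ha
  refine ⟨fun y => f y '' E y, ⟨fun y => image_mono (hE.subset y),
    fun y => (hE.nonempty y).image _, ?_⟩, by simp [hx]⟩
  rintro y z hyz _ ⟨b, hb, rfl⟩
  obtain ⟨c, hc, hbc⟩ := hE.support y z hyz b hb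
  exact ⟨_, ⟨c, hc, rfl⟩, b, hE.subset y hb, c, hE.subset z hc, rfl, rfl, hbc⟩

/-- If every variable has two neighbours or two classes, the values of the variables with two
classes are replaced by representatives of their classes, one variable after the other. -/
theorem satisfiable_of_hasTwoNeighbours_or_hasTwoClasses [Finite X] [Finite D]
    (hI : I.SingletonArcConsistent) (hne : ∀ x, (I.dom x).Nonempty)
    (h : ∀ x, I.HasTwoNeighbours x ∨ I.HasTwoClasses x) : I.Satisfiable := by
  classical
  induction hn : {x | ¬ ∃ a b, I.dom x ⊆ {a, b}}.ncard using Nat.strong_induction_on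
    generalizing I with
  | _ n ih =>
  subst hn
  by_cases hall : ∀ x, (∃ a b, I.dom x ⊆ {a, b}) ∨ I.HasTwoNeighbours x
  · exact satisfiable_of_small_or_hasTwoNeighbours hI hne hall
  push Not at hall
  obtain ⟨V, hbig, hV⟩ := hall
  obtain ⟨P, H, hPH⟩ := (h V).resolve_left hV
  -- representatives of the two classes; if one of them is empty, a single one suffices
  obtain ⟨r, hr⟩ := hne V
  obtain ⟨k, l, hkl⟩ : ∃ k l : D, ∀ a ∈ I.dom V, ∀ b ∈ I.dom V,
      ((if a ∈ H then k else l) = if b ∈ H then k else l) → (a ∈ H ↔ b ∈ H) := by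
    by_cases hH : ∃ k ∈ I.dom V, ∃ l ∈ I.dom V, k ∈ H ∧ l ∉ H
    · obtain ⟨k, -, l, -, hk, hl⟩ := hH
      have : k ≠ l := fun h => hl (h ▸ hk)
      refine ⟨k, l, fun a _ b _ hab => ?_⟩
      by_cases ha : a ∈ H <;> by_cases hb : b ∈ H <;> simp_all
    · push Not at hH
      exact ⟨r, r, fun a ha b hb _ => ⟨fun h => hH a ha b hb h, fun h => hH b hb a ha h⟩⟩
  let f : X → D → D := fun x a => if x = V then (if a ∈ H then k else l) else a
  have hfV : ∀ a, f V a = if a ∈ H then k else l := fun a => if_pos rfl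
  have hf : ∀ {x}, x ≠ V → ∀ a, f x a = a := fun hx a => if_neg hx
  have hdom : ∀ {x}, x ≠ V → (I.mapValues f).dom x = I.dom x := by
    intro x hx
    change f x '' I.dom x = I.dom x
    rw [show f x = id from funext (hf hx), image_id]
  have hdomV : (I.mapValues f).dom V ⊆ {k, l} := by
    rintro _ ⟨a, -, rfl⟩
    rw [hfV]
    split_ifs <;> simp
  have hlt : {x | ¬ ∃ a b, (I.mapValues f).dom x ⊆ {a, b}}.ncard <
      {x | ¬ ∃ a b, I.dom x ⊆ {a, b}}.ncard := by
    refine ncard_lt_ncard ((ssubset_iff_of_subset ?_).2 ⟨V, ?_, fun hV => hV ⟨k, l, hdomV⟩⟩)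
      (toFinite _)
    · intro x hx
      have hxV : x ≠ V := by rintro rfl; exact hx ⟨k, l, hdomV⟩
      change ¬ _ at hx
      rwa [hdom hxV] at hx
    · rintro ⟨a, b, hab⟩
      exact hbig a b hab
  have hstruct : ∀ x, (I.mapValues f).HasTwoNeighbours x ∨ (I.mapValues f).HasTwoClasses x := by
    intro x
    by_cases hxV : x = V
    · subst hxV
      refine Or.inr ⟨x, {k}, fun a ha b hb hab y _ _ q _ hq => ?_⟩
      have : a = b := by
        have h1 := hdomV ha
        have h2 := hdomV hb
        simp only [mem_insert_iff, mem_singleton_iff] at h1 h2 hab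
        grind
      exact this ▸ hq
    rcases h x with ⟨Q, R, hQR⟩ | ⟨Q, G, hQG⟩
    · refine Or.inl ⟨Q, R, fun y hxy hyQ hyR => ?_⟩
      rintro _ ⟨a, ha, rfl⟩ _ ⟨b, hb, rfl⟩
      exact ⟨a, ha, b, hb, rfl, rfl, hQR y hxy hyQ hyR a ha b hb⟩
    · refine Or.inr ⟨Q, G, fun a ha b hb hab y hxy hyQ q _ hq => ?_⟩
      rw [hdom hxV] at ha hb
      obtain ⟨a', -, q', hq', h1, h2, hr⟩ := hq
      obtain rfl : a' = a := (hf hxV a').symm.trans h1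
      exact ⟨b, hb, q', hq', hf hxV b, h2, hQG _ ha b hb hab y hxy hyQ q' hq' hr⟩
  obtain ⟨s, hs, hs'⟩ := ih _ hlt (hI.mapValues f) (fun x => (hne x).image _) hstruct rfl
  -- the value of `V` is chosen in its class so as to fit that of `P`
  obtain ⟨a, ha, hfa, hPa⟩ : ∃ a ∈ I.dom V, f V a = s V ∧ (V ≠ P → I.rel V P a (s P)) := by
    by_cases hVP : V = P
    · obtain ⟨a, ha, hfa⟩ := hs V
      exact ⟨a, ha, hfa, fun h => (h hVP).elim⟩
    · obtain ⟨a, ha, b, -, hfa, hfb, hr⟩ := hs' V P hVP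
      rw [hf (Ne.symm hVP)] at hfb
      exact ⟨a, ha, hfa, fun _ => hfb ▸ hr⟩
  refine satisfiable_of_update (s := s) (x := V) (c := a) (fun y hy => ?_) ha (fun y hy => ?_)
    fun y z hy hz hyz => ?_
  · have := hs y
    rwa [hdom hy] at this
  · by_cases hyP : y = P
    · subst hyP; exact hPa hy
    · obtain ⟨a', ha', b, hb, hfa', hfb, hr⟩ := hs' V y hy
      rw [hf hy.symm] at hfb
      have : f V a' = f V a := hfa'.trans hfa.symm
      rw [hfV, hfV] at this
      subst hfb
      exact hPH a' ha' a ha (hkl a' ha' a ha this) y hy hyP _ hb hr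
  · obtain ⟨b, -, c, -, hfb, hfc, hr⟩ := hs' y z hyz
    rw [hf hy] at hfb
    rw [hf hz] at hfc
    exact hfb ▸ hfc ▸ hr

end Instance

namespace Pattern

variable {X : Type u} {D : Type v} {I : Instance X D}

/-- After the removal of dominated values, the absence of `Q1` gives every variable two neighbours
or two classes. -/
theorem Admits.satisfiable_of_Q1 [Finite X] [Finite D] (hI : Q1.Admits I)
    (ih : Q1.SolvesBelow I) : I.Satisfiable := by
  rcases hI.satisfiable_or_prefers_nonempty ih with hsat | hpref
  · exact hsat
  refine Instance.satisfiable_of_hasTwoNeighbours_or_hasTwoClasses hI.sac hI.nonempty fun V => ?_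
  have hcyc : ∀ a ∈ I.dom V, ∀ b ∈ I.dom V, ∀ c ∈ I.dom V, ∀ P ∈ prefers I V a b,
      ∀ Q ∈ prefers I V b c, ∀ R ∈ prefers I V c a, P = Q ∨ Q = R ∨ P = R := by
    rintro a ha b hb c hc P ⟨hVP, p, hp, hap, hbp⟩ Q ⟨hVQ, q, hq, hbq, hcq⟩ R ⟨hVR, r, hr, hcr, har⟩
    by_contra! hcon
    refine hI.avoids (occursIn_Q1 hVP.symm hcon.2.2 hcon.1 hVR hVQ hcon.2.1.symm hp hc hb ha hr hq
      ((I.rel_comm hVP).1 hap) hcr hbq ?_ har hcq)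
    exact fun h => hbp ((I.rel_comm hVP).2 h)
  rcases exists_two_or_two_classes (prefers_self V) (prefers_subset_union V) (hpref V) hcyc
    (hI.nonempty V) ⟨V⟩ with ⟨P, R, h⟩ | ⟨P, H, h⟩
  · refine Or.inl ⟨P, R, fun y hVy hyP hyR a ha q hq => ?_⟩
    obtain ⟨b, hb, hqb⟩ := hI.sac.exists_support hVy.symm hq
    by_contra hn
    exact (h b hb a ha ⟨hVy, q, hq, (I.rel_comm hVy).2 hqb, hn⟩).elim hyP hyR
  · refine Or.inr ⟨P, H, fun a ha b hb hab y hVy hyP q hq hr => ?_⟩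
    by_contra hn
    exact hyP (h a ha b hb hab ⟨hVy, q, hq, hr, hn⟩)

end Pattern

end BinaryCSP

theorem mainTheorem1 :
    BinaryCSP.Pattern.SACSolvable.{u, v} BinaryCSP.Pattern.Q1 ∧
    BinaryCSP.Pattern.SACSolvable.{u, v} BinaryCSP.Pattern.Q2 ∧
    BinaryCSP.Pattern.SACSolvable.{u, v} BinaryCSP.Pattern.R5 ∧
    BinaryCSP.Pattern.SACSolvable.{u, v} BinaryCSP.Pattern.R8 ∧
    BinaryCSP.Pattern.SACSolvable.{u, v} BinaryCSP.Pattern.R7minus ∧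
    (∀ (X : Type u) (D : Type v) [Finite X] [Finite D],
      ∀ I ∈ BinaryCSP.Pattern.R5.CSP X D, I.SingletonArcConsistent →
        ∀ x y : X, x ≠ y → ((I.deleteConstraint x y).Satisfiable ↔ I.Satisfiable)) := by
  refine ⟨.of_admits fun X D _ _ I hI ih => hI.satisfiable_of_Q1 ih,
    .of_admits fun X D _ _ I hI ih => hI.satisfiable_of_Q2 ih,
    .of_admits fun X D _ _ I hI ih => hI.satisfiable_of_R5 ih,
    .of_admits fun X D _ _ I hI ih => hI.satisfiable_of_R8 ih,
    .of_admits fun X D _ _ I hI ih => hI.satisfiable_of_R7minus ih, ?_⟩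
  intro X D _ _ I hI hsac x y _
  constructor
  · -- a solution of the relaxed instance shows that the domains are nonempty
    rintro ⟨s, hs, -⟩
    exact BinaryCSP.Pattern.satisfiable_of_admits
      (fun J hJ ih => BinaryCSP.Pattern.Admits.satisfiable_of_R5 hJ ih) I
      ⟨hI, hsac, fun z => ⟨s z, hs z⟩⟩
  · rintro ⟨s, hs, hs'⟩
    exact ⟨s, hs, fun z w hzw => Or.inl (hs' z w hzw)⟩
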